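/- Let $\mathcal X,\mathcal Y$ be arbitrary measurable spaces (finite, infinite or continuous alphabets), $W$ a Markov kernel from $\mathcal X$ to $\mathcal Y$ (a memoryless channel, with $W^n(\cdot|\mathbf x)=\prod_k W(\cdot|x_k)$), $P$ a probability measure on $\mathcal X$, $q:\mathcal X\times\mathcal Y\to\mathbb R$ a measurable decoding metric and $d:\mathcal X\times\mathcal X\to\mathbb R$ a measurable symmetric distance function, extended additively by $q(\mathbf x,\mathbf y)=\frac1n\sum_k q(x_k,y_k)$ and $d(\mathbf x,\mathbf x')=\frac1n\sum_k d(x_k,x'_k)$. Let $c_1,\dots,c_L$ ($L\ge 0$, possibly none) be measurable $P$-integrable system costs with thresholds $\Gamma_l>\mathbb E_P[c_l(X)]$. For $\Delta\in\mathbb R$, $r,s\ge0$, $\rho\in[0,1]$ and measurable $a:\mathcal X\to\mathbb R$ with finite mean $\phi_a=\mathbb E_P[a(X)]$, put $$A^{\mathrm{rate}}_{r,a}(x)=-\log\int P(dx')\,e^{a(x')-\phi_a}e^{-r(d(x,x')-\Delta)},$$ $$A^{\mathrm{exp}}_{\rho,r,s,a}(x)=-\log\int W(dy|x)\left(\frac{\int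 P(dx')\,e^{sq(x',y)}e^{a(x')}e^{r(d(x,x')-\Delta)}}{e^{sq(x,y)}e^{a(x)}}\right)^{\rho}.$$ Call the parameters admissible if the cost function $A^{\mathrm{rate}}_{r,a}$ (respectively $A^{\mathrm{exp}}_{\rho,r,s,a}$) is finite $P$-almost surely and has a finite mean under $P$, and define $$R_{\mathrm{dual}}=\sup_{r,a}\mathbb E_P[A^{\mathrm{rate}}_{r,a}(X)],\qquad E_{\mathrm{dual}}(R)=\sup_{\rho,r,s,a}\Big(\mathbb E_P[A^{\mathrm{exp}}_{\rho,r,s,a}(X)]-\rho R\Big),$$ the suprema being over admissible parameters, with values in $[0,\infty]$. For four auxiliary costs $a_1,\dots,a_4$ with means $\phi_j=\mathbb E_P[a_j(X)]$, $\epsilon>0$ and a block length $n$, let $P_{\mathbf X}$ be the product law $P^n$ conditioned on $\big|\frac1n\sum_k a_j(x_k)-\phi_j\big|\le\epsilon$ for $j=1,\dots,4$ and on $\frac1n\sum_k c_l(x_k)\le\Gamma_l$ for all $l$. Draw the codewords recursively: given $\mathbf x_1,\dots,\mathbf x_{m-1}$, the codeword $\mathbf x_m$ has law $P_{\mathbf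 X}$ conditioned on $d(\mathbf x_i,\cdot)>\Delta$ for all $i<m$; let $\mu_m(\mathbf x_1^{m-1})$ be the $P_{\mathbf X}$-probability of that event. Let $\bar P_e^{(n)}$ be the ensemble average over this random codebook of the error probability (equiprobable messages, decoder maximizing $q(\mathbf x_i,\mathbf y)$, ties counted as errors). **Claim.** Let $R>0$, $\delta>0$ and $\Delta\in\mathbb R$ satisfy $R\le R_{\mathrm{dual}}-2\delta$. (1) For every real $E<E_{\mathrm{dual}}(R)$ there are admissible $(r_1,a_1)$ with $\mathbb E_P[A^{\mathrm{rate}}_{r_1,a_1}(X)]>R+\delta$ and admissible $(\rho,r,s,a)$ with $\mathbb E_P[A^{\mathrm{exp}}_{\rho,r,s,a}(X)]-\rho R>E$ such that, for the auxiliary costs $a_1$, $a_2=A^{\mathrm{rate}}_{r_1,a_1}$, $a_3=a$, $a_4=A^{\mathrm{exp}}_{\rho,r,s,a}$ and for all sufficiently small $\epsilon>0$, the following holds for all sufficiently large $n$ and all integers $1\le M_n\le e^{nR}$: the recursive construction with $M_n$ codewords is well defined, with $\mu_m(\mathbf X_1^{m-1})\ge 1-e^{-n\delta}$ almost surely for all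 $m\le M_n$, and $\bar P_e^{(n)}\le e^{-nE}$. (2) Consequently every real $E\le E_{\mathrm{dual}}(R)$ is an achievable error exponent at rate $R$: for every $\epsilon>0$ there are codebooks of block length $n$ which, for all large $n$, have at least $e^{n(R-\epsilon)}$ codewords, all satisfying the system cost constraints, and whose error probability $P_e$ satisfies $\liminf_{n\to\infty}-\frac1n\log P_e\ge E-\epsilon$. -/

import Mathlib

open MeasureTheory ProbabilityTheory Filter

namespace RGV

noncomputable section

/-- Normalized additive extension of a single-letter function: `(1/n) ∑ f(x_k)`. -/
def avg {α : Type*} {n : ℕ} (f : α → ℝ) (x : Fin n → α) : ℝ :=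
  (∑ k, f (x k)) / n

/-- Normalized additive extension of a two-letter function: `(1/n) ∑ f(x_k, y_k)`
(used for the distance function and for the decoding metric). -/
def avg₂ {α β : Type*} {n : ℕ} (f : α → β → ℝ) (x : Fin n → α) (y : Fin n → β) : ℝ :=
  (∑ k, f (x k) (y k)) / n

section Dual

variable {𝒳 𝒴 : Type*} [MeasurableSpace 𝒳] [MeasurableSpace 𝒴]

/-- `∑_{x'} P(x') e^{a(x') - φ_a} e^{-r (d(x,x') - Δ)}`, with `φ_a = E_P[a(X)]`. -/
def rateMoment (P : Measure 𝒳) (d : 𝒳 → 𝒳 → ℝ) (Δ r : ℝ) (a : 𝒳 → ℝ) (x : 𝒳) : ENNReal :=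
  ∫⁻ x', ENNReal.ofReal
    (Real.exp (a x' - ∫ z, a z ∂P) * Real.exp (-r * (d x x' - Δ))) ∂P

/-- The auxiliary cost `-log ∑_{x'} P(x') e^{a(x') - φ_a} e^{-r (d(x,x') - Δ)}`. -/
def rateCost (P : Measure 𝒳) (d : 𝒳 → 𝒳 → ℝ) (Δ r : ℝ) (a : 𝒳 → ℝ) (x : 𝒳) : ℝ :=
  -Real.log (rateMoment P d Δ r a x).toReal

/-- Parameters of the dual rate expression: `r ≥ 0` and a function `a` such that the two
auxiliary costs involved are (almost surely) finite and have a finite mean under `P`. -/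
structure RateParams (P : Measure 𝒳) (d : 𝒳 → 𝒳 → ℝ) (Δ r : ℝ) (a : 𝒳 → ℝ) : Prop where
  r_nonneg : 0 ≤ r
  measurable : Measurable a
  integrable : Integrable a P
  finite : ∀ᵐ x ∂P, rateMoment P d Δ r a x ≠ ⊤
  integrable_cost : Integrable (rateCost P d Δ r a) P

/-- `-∑_x P(x) log ∑_{x'} P(x') e^{a(x') - φ_a} e^{-r (d(x,x') - Δ)}`. -/
def rateValue (P : Measure 𝒳) (d : 𝒳 → 𝒳 → ℝ) (Δ r : ℝ) (a : 𝒳 → ℝ) : ℝ :=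
  ∫ x, rateCost P d Δ r a x ∂P

/-- The supremum over `r ≥ 0` and `a` in the dual rate condition. -/
def dualRate (P : Measure 𝒳) (d : 𝒳 → 𝒳 → ℝ) (Δ : ℝ) : EReal :=
  sSup {v : EReal | ∃ (r : ℝ) (a : 𝒳 → ℝ),
    RateParams P d Δ r a ∧ v = (rateValue P d Δ r a : ℝ)}

/-- `∑_y W(y|x) (∑_{x'} P(x') e^{s q(x',y)} e^{a(x')} e^{r (d(x,x') - Δ)}
/ (e^{s q(x,y)} e^{a(x)}))^ρ`. -/
def expMoment (P : Measure 𝒳) (W : Kernel 𝒳 𝒴) (q : 𝒳 → 𝒴 → ℝ) (d : 𝒳 → 𝒳 → ℝ)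
    (Δ ρ r s : ℝ) (a : 𝒳 → ℝ) (x : 𝒳) : ENNReal :=
  ∫⁻ y, ((∫⁻ x', ENNReal.ofReal
      (Real.exp (s * q x' y) * Real.exp (a x') * Real.exp (r * (d x x' - Δ))) ∂P)
    / ENNReal.ofReal (Real.exp (s * q x y) * Real.exp (a x))) ^ ρ ∂(W x)

/-- The auxiliary cost given by minus the logarithm of `expMoment`. -/
def expCost (P : Measure 𝒳) (W : Kernel 𝒳 𝒴) (q : 𝒳 → 𝒴 → ℝ) (d : 𝒳 → 𝒳 → ℝ)
    (Δ ρ r s : ℝ) (a : 𝒳 → ℝ) (x : 𝒳) : ℝ :=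
  -Real.log (expMoment P W q d Δ ρ r s a x).toReal

/-- Parameters of the dual exponent: `ρ ∈ [0,1]`, `r ≥ 0`, `s ≥ 0` and a function `a` such that
the two auxiliary costs involved are (almost surely) finite and have a finite mean under `P`. -/
structure ExpParams (P : Measure 𝒳) (W : Kernel 𝒳 𝒴) (q : 𝒳 → 𝒴 → ℝ) (d : 𝒳 → 𝒳 → ℝ)
    (Δ ρ r s : ℝ) (a : 𝒳 → ℝ) : Prop where
  ρ_nonneg : 0 ≤ ρ
  ρ_le_one : ρ ≤ 1
  r_nonneg : 0 ≤ r
  s_nonneg : 0 ≤ s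
  measurable : Measurable a
  integrable : Integrable a P
  finite : ∀ᵐ x ∂P, expMoment P W q d Δ ρ r s a x ≠ ⊤
  integrable_cost : Integrable (expCost P W q d Δ ρ r s a) P

/-- The objective function of the dual exponent at fixed parameters. -/
def expValue (P : Measure 𝒳) (W : Kernel 𝒳 𝒴) (q : 𝒳 → 𝒴 → ℝ) (d : 𝒳 → 𝒳 → ℝ)
    (Δ R ρ r s : ℝ) (a : 𝒳 → ℝ) : ℝ :=
  (∫ x, expCost P W q d Δ ρ r s a x ∂P) - ρ * R

/-- The dual exponent: supremum over `ρ ∈ [0,1]`, `r ≥ 0`, `s ≥ 0` and `a`. -/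
def dualExponent (P : Measure 𝒳) (W : Kernel 𝒳 𝒴) (q : 𝒳 → 𝒴 → ℝ) (d : 𝒳 → 𝒳 → ℝ)
    (Δ R : ℝ) : EReal :=
  sSup {v : EReal | ∃ (ρ r s : ℝ) (a : 𝒳 → ℝ),
    ExpParams P W q d Δ ρ r s a ∧ v = (expValue P W q d Δ R ρ r s a : ℝ)}

end Dual

section Coding

variable {𝒳 𝒴 : Type*} [MeasurableSpace 𝒳] [MeasurableSpace 𝒴]

/-- Sequences whose auxiliary costs `a_j` are all within `ε` of their means `φ_j = E_P[a_j(X)]`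
and which satisfy the system constraints `(1/n) ∑ c_l(x_k) ≤ Γ_l`. -/
def costSet (P : Measure 𝒳) {J L : ℕ} (a : Fin J → 𝒳 → ℝ) (ε : ℝ)
    (c : Fin L → 𝒳 → ℝ) (Γ : Fin L → ℝ) (n : ℕ) : Set (Fin n → 𝒳) :=
  {x | (∀ j, |avg (a j) x - ∫ z, a j z ∂P| ≤ ε) ∧ ∀ l, avg (c l) x ≤ Γ l}

/-- The cost-constrained distribution `P_X`: i.i.d. `P`, conditioned on `costSet`. -/
def inputLaw (P : Measure 𝒳) {J L : ℕ} (a : Fin J → 𝒳 → ℝ) (ε : ℝ)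
    (c : Fin L → 𝒳 → ℝ) (Γ : Fin L → ℝ) (n : ℕ) : Measure (Fin n → 𝒳) :=
  cond (Measure.pi fun _ : Fin n => P) (costSet P a ε c Γ n)

/-- Sequences at distance greater than `Δ` from each of the given codewords. -/
def farSet {n m : ℕ} (d : 𝒳 → 𝒳 → ℝ) (Δ : ℝ) (C : Fin m → Fin n → 𝒳) : Set (Fin n → 𝒳) :=
  {x | ∀ i, Δ < avg₂ d (C i) x}

/-- Law of the first `m` codewords of the recursive construction: given the codewords drawn so
far, the next one has law `Q` conditioned on being at distance greater than `Δ` from all of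
them. -/
def codebookLaw {n : ℕ} (Q : Measure (Fin n → 𝒳)) (d : 𝒳 → 𝒳 → ℝ) (Δ : ℝ) :
    (m : ℕ) → Measure (Fin m → Fin n → 𝒳)
  | 0 => Measure.dirac Fin.elim0
  | m + 1 => (codebookLaw Q d Δ m).bind fun C =>
      (cond Q (farSet d Δ C)).map fun x => Fin.snoc (α := fun _ => Fin n → 𝒳) C x

/-- Error probability of a codebook over the memoryless channel `W` with equiprobable messages
and the maximum-metric decoder for `q`; ties are counted as errors. -/
def errorProb {n M : ℕ} (W : Kernel 𝒳 𝒴) (q : 𝒳 → 𝒴 → ℝ) (C : Fin M → Fin n → 𝒳) : ENNReal :=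
  (∑ m, (Measure.pi fun k => W (C m k))
    {y : Fin n → 𝒴 | ∃ i, i ≠ m ∧ avg₂ q (C m) y ≤ avg₂ q (C i) y}) / M

/-- Ensemble average error probability of the recursive construction. -/
def ensembleError {n : ℕ} (W : Kernel 𝒳 𝒴) (q : 𝒳 → 𝒴 → ℝ) (Q : Measure (Fin n → 𝒳))
    (d : 𝒳 → 𝒳 → ℝ) (Δ : ℝ) (M : ℕ) : ENNReal :=
  ∫⁻ C, errorProb W q C ∂(codebookLaw Q d Δ M)

/-- `(R, E)` is an achievable rate-exponent pair with metric `q` and system constraints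
`(1/n) ∑ c_l(x_k) ≤ Γ_l` on every codeword. -/
def Achievable (W : Kernel 𝒳 𝒴) (q : 𝒳 → 𝒴 → ℝ) {L : ℕ} (c : Fin L → 𝒳 → ℝ)
    (Γ : Fin L → ℝ) (R E : ℝ) : Prop :=
  ∀ ε : ℝ, 0 < ε → ∃ (M : ℕ → ℕ) (C : (n : ℕ) → Fin (M n) → Fin n → 𝒳),
    (∀ᶠ n : ℕ in atTop, Real.exp (n * (R - ε)) ≤ M n ∧ ∀ m l, avg (c l) (C n m) ≤ Γ l) ∧
    ((E - ε : ℝ) : EReal) ≤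
      liminf (fun n : ℕ => -(ENNReal.log (errorProb W q (C n))) / (n : EReal)) atTop

end Coding

end

end RGV

/-! Write `Q` for the constrained input law. If every conditioning event of the recursion has
`Q`-probability at least `κ`, each draw costs at most a factor `κ⁻¹`. One codeword then has law at
most `κ⁻¹ Q`, and an ordered pair of distinct codewords has law at most `κ⁻² Q × Q` restricted to
pairs farther apart than `Δ` (`lintegral_codeword_le`, `lintegral_codeword_pair_le`). These
marginals alone give a random-coding union bound with loss `κ⁻²` (`ensembleError_le`), although the
codewords are dependent.

The rest is Chernoff bounding. The constraint set has `Pⁿ`-probability at least 1/2 for large `n`,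
by the law of large numbers, so `Q ≤ 2 Pⁿ`. On that set the empirical means of the auxiliary costs
are their expectations up to `ε`, so exponential moments under `Pⁿ` factor over coordinates and
become explicit. For the rate costs, the `Q`-probability of a word near a given codeword is about
`e^{-n rateValue}` (`cond_near_le`). A union bound over fewer than `e^{nR}` codewords leaves at most
`e^{-nδ}`, so `κ = 1 - e^{-nδ}` is legitimate. For the exponent costs, `min(1, z) ≤ z^ρ` bounds the
union bound by about `e^{-n expValue}` (`lintegral_min_confusionProb_le`). Strict gaps below the
suprema absorb every `ε` and constant. Some codebook does no worse than the average, which yields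
achievability. -/

namespace RGV

/-! ### Measurability, the codebook recursion and product kernels. -/

section Measurability

variable {𝒳 𝒴 : Type*} [MeasurableSpace 𝒳] [MeasurableSpace 𝒴]

lemma measurable_avg {n : ℕ} {f : 𝒳 → ℝ} (hf : Measurable f) :
    Measurable fun x : Fin n → 𝒳 => avg f x := by
  unfold avg
  fun_prop

lemma measurable_avg₂ {n : ℕ} {f : 𝒳 → 𝒴 → ℝ} (hf : Measurable fun p : 𝒳 × 𝒴 => f p.1 p.2) :
    Measurable fun p : (Fin n → 𝒳) × (Fin n → 𝒴) => avg₂ f p.1 p.2 := by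
  unfold avg₂
  refine Measurable.div_const (Finset.measurable_sum _ fun k _ => ?_) _
  exact hf.comp (f := fun p : (Fin n → 𝒳) × (Fin n → 𝒴) => (p.1 k, p.2 k)) (by fun_prop)

lemma measurableSet_costSet (P : Measure 𝒳) {J L : ℕ} {a : Fin J → 𝒳 → ℝ}
    (ha : ∀ j, Measurable (a j)) (ε : ℝ) {c : Fin L → 𝒳 → ℝ} (hc : ∀ l, Measurable (c l))
    (Γ : Fin L → ℝ) (n : ℕ) : MeasurableSet (costSet P a ε c Γ n) := by
  have h : costSet P a ε c Γ n =
      (⋂ j, {x : Fin n → 𝒳 | |avg (a j) x - ∫ z, a j z ∂P| ≤ ε}) ∩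
        ⋂ l, {x : Fin n → 𝒳 | avg (c l) x ≤ Γ l} := by
    ext x
    simp [costSet]
  rw [h]
  refine MeasurableSet.inter (MeasurableSet.iInter fun j => ?_) (MeasurableSet.iInter fun l => ?_)
  · exact measurableSet_le ((measurable_avg (ha j)).sub_const _).abs measurable_const
  · exact measurableSet_le (measurable_avg (hc l)) measurable_const

lemma measurableSet_farSet_prod {n m : ℕ} {d : 𝒳 → 𝒳 → ℝ}
    (hd : Measurable fun p : 𝒳 × 𝒳 => d p.1 p.2) (Δ : ℝ) :
    MeasurableSet {p : (Fin m → Fin n → 𝒳) × (Fin n → 𝒳) | p.2 ∈ farSet d Δ p.1} := by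
  have h : {p : (Fin m → Fin n → 𝒳) × (Fin n → 𝒳) | p.2 ∈ farSet d Δ p.1} =
      ⋂ i, {p : (Fin m → Fin n → 𝒳) × (Fin n → 𝒳) | Δ < avg₂ d (p.1 i) p.2} := by
    ext p
    simp [farSet]
  rw [h]
  refine MeasurableSet.iInter fun i => measurableSet_lt measurable_const ?_
  exact (measurable_avg₂ hd).comp
    (f := fun p : (Fin m → Fin n → 𝒳) × (Fin n → 𝒳) => (p.1 i, p.2)) (by fun_prop)

lemma measurableSet_farSet {n m : ℕ} {d : 𝒳 → 𝒳 → ℝ}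
    (hd : Measurable fun p : 𝒳 × 𝒳 => d p.1 p.2) (Δ : ℝ) (C : Fin m → Fin n → 𝒳) :
    MeasurableSet (farSet d Δ C) :=
  measurable_prodMk_left (x := C) (measurableSet_farSet_prod hd Δ)

lemma measurable_snoc {n m : ℕ} :
    Measurable fun p : (Fin m → Fin n → 𝒳) × (Fin n → 𝒳) =>
      (Fin.snoc (α := fun _ => Fin n → 𝒳) p.1 p.2 : Fin (m + 1) → Fin n → 𝒳) := by
  refine measurable_pi_lambda _ fun i => ?_
  refine Fin.lastCases ?_ (fun j => ?_) i
  · simpa using measurable_snd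
  · simp only [Fin.snoc_castSucc]
    exact (measurable_pi_apply j).comp measurable_fst

lemma measurable_snoc_left {n m : ℕ} (C : Fin m → Fin n → 𝒳) :
    Measurable fun x : Fin n → 𝒳 =>
      (Fin.snoc (α := fun _ => Fin n → 𝒳) C x : Fin (m + 1) → Fin n → 𝒳) :=
  measurable_snoc.comp measurable_prodMk_left

/-- What makes `Measure.bind` in `codebookLaw` meaningful: on each measurable set the conditional
law is a quotient of measures of sections of a jointly measurable set. -/
lemma measurable_codebook_step {n m : ℕ} (Q : Measure (Fin n → 𝒳)) [SFinite Q] {d : 𝒳 → 𝒳 → ℝ}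
    (hd : Measurable fun p : 𝒳 × 𝒳 => d p.1 p.2) (Δ : ℝ) :
    Measurable fun C : Fin m → Fin n → 𝒳 =>
      (cond Q (farSet d Δ C)).map fun x =>
        (Fin.snoc (α := fun _ => Fin n → 𝒳) C x : Fin (m + 1) → Fin n → 𝒳) := by
  refine Measure.measurable_of_measurable_coe _ fun s hs => ?_
  have h (C : Fin m → Fin n → 𝒳) : ((cond Q (farSet d Δ C)).map fun x =>
        (Fin.snoc (α := fun _ => Fin n → 𝒳) C x : Fin (m + 1) → Fin n → 𝒳)) s
      = (Q (farSet d Δ C))⁻¹ * Q (farSet d Δ C ∩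
        (fun x => (Fin.snoc (α := fun _ => Fin n → 𝒳) C x : Fin (m + 1) → Fin n → 𝒳)) ⁻¹' s) := by
    rw [Measure.map_apply (measurable_snoc_left C) hs, cond_apply (measurableSet_farSet hd Δ C)]
  simp only [h]
  refine Measurable.mul (Measurable.inv ?_) ?_
  · exact measurable_measure_prodMk_left (measurableSet_farSet_prod hd Δ)
  · exact measurable_measure_prodMk_left
      ((measurableSet_farSet_prod hd Δ).inter (measurable_snoc hs))

/-- The integrated form of the recursion; every induction on the number of codewords runs through
it. -/
lemma lintegral_codebookLaw_succ {n m : ℕ} (Q : Measure (Fin n → 𝒳)) [SFinite Q]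
    {d : 𝒳 → 𝒳 → ℝ} (hd : Measurable fun p : 𝒳 × 𝒳 => d p.1 p.2) (Δ : ℝ)
    {f : (Fin (m + 1) → Fin n → 𝒳) → ENNReal} (hf : Measurable f) :
    ∫⁻ C, f C ∂(codebookLaw Q d Δ (m + 1)) =
      ∫⁻ C, ∫⁻ x, f (Fin.snoc (α := fun _ => Fin n → 𝒳) C x) ∂(cond Q (farSet d Δ C))
        ∂(codebookLaw Q d Δ m) := by
  rw [codebookLaw, Measure.lintegral_bind (measurable_codebook_step Q hd Δ).aemeasurable
    hf.aemeasurable]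
  refine lintegral_congr fun C => ?_
  rw [lintegral_map hf (measurable_snoc_left C)]

/-- Coordinates are independent, so moments tensorize. The factors may vary with `k`, so this serves
both `Pⁿ` and the channel output law given a word. -/
lemma lintegral_pi_prod {n : ℕ} {α : Type*} [MeasurableSpace α] (μ : Fin n → Measure α)
    [∀ k, IsProbabilityMeasure (μ k)] {f : Fin n → α → ENNReal} (hf : ∀ k, Measurable (f k)) :
    ∫⁻ x, ∏ k, f k (x k) ∂(Measure.pi μ) = ∏ k, ∫⁻ z, f k z ∂(μ k) := by
  rw [lintegral_prod_eq_prod_lintegral_of_indepFun Finset.univ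
    (fun k (x : Fin n → α) => f k (x k))
    (iIndepFun_pi fun k => (hf k).aemeasurable) fun k => (hf k).comp (measurable_pi_apply k)]
  refine Finset.prod_congr rfl fun k _ => ?_
  exact (measurePreserving_eval μ k).lintegral_comp (hf k)

/-- The memoryless extension of a channel. -/
noncomputable def prodChannel (W : Kernel 𝒳 𝒴) [IsMarkovKernel W] (n : ℕ) :
    Kernel (Fin n → 𝒳) (Fin n → 𝒴) where
  toFun x := Measure.pi fun k => W (x k)
  measurable' := by
    refine Measurable.measure_of_isPiSystem_of_isProbabilityMeasure generateFrom_pi.symm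
      isPiSystem_pi ?_
    rintro _ ⟨t, ht, rfl⟩
    simp only [Measure.pi_pi]
    refine Finset.measurable_prod _ fun k _ => ?_
    exact (Kernel.measurable_coe W (ht k trivial)).comp (measurable_pi_apply k)

lemma prodChannel_apply (W : Kernel 𝒳 𝒴) [IsMarkovKernel W] {n : ℕ} (x : Fin n → 𝒳) :
    prodChannel W n x = Measure.pi fun k => W (x k) := rfl

instance (W : Kernel 𝒳 𝒴) [IsMarkovKernel W] (n : ℕ) : IsMarkovKernel (prodChannel W n) :=
  ⟨fun x => by rw [prodChannel_apply]; infer_instance⟩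

lemma measurable_wordError {n M : ℕ} (W : Kernel 𝒳 𝒴) [IsMarkovKernel W] {q : 𝒳 → 𝒴 → ℝ}
    (hq : Measurable fun p : 𝒳 × 𝒴 => q p.1 p.2) (m : Fin M) :
    Measurable fun C : Fin M → Fin n → 𝒳 => (Measure.pi fun k => W (C m k))
      {y : Fin n → 𝒴 | ∃ i, i ≠ m ∧ avg₂ q (C m) y ≤ avg₂ q (C i) y} := by
  have hq' (i : Fin M) : Measurable fun p : (Fin M → Fin n → 𝒳) × (Fin n → 𝒴) =>
      avg₂ q (p.1 i) p.2 :=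
    (measurable_avg₂ hq).comp
      (f := fun p : (Fin M → Fin n → 𝒳) × (Fin n → 𝒴) => (p.1 i, p.2)) (by fun_prop)
  have hs : MeasurableSet {p : (Fin M → Fin n → 𝒳) × (Fin n → 𝒴) |
      ∃ i, i ≠ m ∧ avg₂ q (p.1 m) p.2 ≤ avg₂ q (p.1 i) p.2} := by
    simp only [Set.ofPred_exists, Set.ofPred_and]
    exact MeasurableSet.iUnion fun i =>
      (MeasurableSet.const _).inter (measurableSet_le (hq' m) (hq' i))
  exact Kernel.measurable_kernel_prodMk_left
    (κ := (prodChannel W n).comap (fun C : Fin M → Fin n → 𝒳 => C m) (measurable_pi_apply m)) hs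

lemma measurable_errorProb {n M : ℕ} (W : Kernel 𝒳 𝒴) [IsMarkovKernel W] {q : 𝒳 → 𝒴 → ℝ}
    (hq : Measurable fun p : 𝒳 × 𝒴 => q p.1 p.2) :
    Measurable fun C : Fin M → Fin n → 𝒳 => errorProb W q C :=
  Measurable.div_const (Finset.measurable_sum _ fun m _ => measurable_wordError W hq m) _

lemma measurableSet_far {n : ℕ} {d : 𝒳 → 𝒳 → ℝ}
    (hd : Measurable fun p : 𝒳 × 𝒳 => d p.1 p.2) (Δ : ℝ) (x : Fin n → 𝒳) :
    MeasurableSet {x' : Fin n → 𝒳 | Δ < avg₂ d x x'} :=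
  measurableSet_lt measurable_const ((measurable_avg₂ hd).comp measurable_prodMk_left)

end Measurability

/-! ### Change of measure for the recursive ensemble and the union bound. -/

section Codebook

variable {𝒳 𝒴 : Type*} [MeasurableSpace 𝒳] [MeasurableSpace 𝒴]

lemma lintegral_cond_le {α : Type*} [MeasurableSpace α] (Q : Measure α) {s : Set α}
    {κ : ENNReal} (hκ : κ ≤ Q s) (f : α → ENNReal) :
    ∫⁻ x, f x ∂(cond Q s) ≤ κ⁻¹ * ∫⁻ x in s, f x ∂Q := by
  rw [ProbabilityTheory.cond, lintegral_smul_measure, smul_eq_mul]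
  gcongr

variable {n : ℕ} {Q : Measure (Fin n → 𝒳)} [IsProbabilityMeasure Q] {d : 𝒳 → 𝒳 → ℝ} {Δ : ℝ}

/-- Conditioning is absolutely continuous, so `Q`-null sets stay null at each draw. No lower bound
on the conditioning events is needed: a null event only produces the zero measure. -/
lemma ae_codebookLaw_mem (hd : Measurable fun p : 𝒳 × 𝒳 => d p.1 p.2) {G : Set (Fin n → 𝒳)}
    (hG : MeasurableSet G) (hQ : ∀ᵐ x ∂Q, x ∈ G) (m : ℕ) :
    ∀ᵐ C ∂(codebookLaw Q d Δ m), ∀ i, C i ∈ G := by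
  induction m with
  | zero => exact ae_of_all _ fun C i => i.elim0
  | succ m ih =>
    have hm : MeasurableSet {C : Fin (m + 1) → Fin n → 𝒳 | ¬ ∀ i, C i ∈ G} := by
      have : {C : Fin (m + 1) → Fin n → 𝒳 | ¬ ∀ i, C i ∈ G} =
          (⋂ i, (fun C : Fin (m + 1) → Fin n → 𝒳 => C i) ⁻¹' G)ᶜ := by
        ext C
        simp
      rw [this]
      exact (MeasurableSet.iInter fun i => measurable_pi_apply i hG).compl
    rw [ae_iff, ← lintegral_indicator_one hm,
      lintegral_codebookLaw_succ Q hd Δ (measurable_one.indicator hm)]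
    refine (lintegral_congr_ae ?_).trans lintegral_zero
    filter_upwards [ih] with C hC
    refine (lintegral_congr_ae ?_).trans lintegral_zero
    filter_upwards [cond_absolutelyContinuous.ae_le hQ] with x hx
    rw [Set.indicator_of_notMem]
    simp only [Set.mem_ofPred_eq, not_not]
    intro i
    refine Fin.lastCases ?_ (fun j => ?_) i
    · simpa using hx
    · simpa using hC j

variable {κ : ENNReal} {M : ℕ}

/-- Mass can be lost only when a conditioning event is `Q`-null, which `κ ≠ 0` excludes. -/
lemma isProbabilityMeasure_codebookLaw (hd : Measurable fun p : 𝒳 × 𝒳 => d p.1 p.2)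
    (hκ : κ ≠ 0) (hM : ∀ m < M, ∀ᵐ C ∂(codebookLaw Q d Δ m), κ ≤ Q (farSet d Δ C))
    {m : ℕ} (hm : m ≤ M) : IsProbabilityMeasure (codebookLaw Q d Δ m) := by
  induction m with
  | zero => rw [codebookLaw]; infer_instance
  | succ m ih =>
    have := ih (by omega)
    constructor
    rw [← lintegral_one, lintegral_codebookLaw_succ Q hd Δ (f := fun _ => 1) measurable_const]
    rw [← measure_univ (μ := codebookLaw Q d Δ m), ← lintegral_one]
    refine lintegral_congr_ae ?_
    filter_upwards [hM m (by omega)] with C hC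
    have : Q (farSet d Δ C) ≠ 0 := fun h => hκ (by simpa [h] using hC)
    have := cond_isProbabilityMeasure this
    simp

lemma lintegral_codeword_le (hd : Measurable fun p : 𝒳 × 𝒳 => d p.1 p.2)
    (hκ : κ ≠ 0) (hM : ∀ m < M, ∀ᵐ C ∂(codebookLaw Q d Δ m), κ ≤ Q (farSet d Δ C))
    {m : ℕ} (hm : m ≤ M) (i : Fin m) {f : (Fin n → 𝒳) → ENNReal} (hf : Measurable f) :
    ∫⁻ C, f (C i) ∂(codebookLaw Q d Δ m) ≤ κ⁻¹ * ∫⁻ x, f x ∂Q := by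
  induction m with
  | zero => exact i.elim0
  | succ m ih =>
    have := isProbabilityMeasure_codebookLaw hd hκ hM (m := m) (by omega)
    rw [lintegral_codebookLaw_succ Q hd Δ (f := fun C => f (C i))
      (hf.comp (measurable_pi_apply i))]
    refine Fin.lastCases ?_ (fun j => ?_) i
    · simp only [Fin.snoc_last]
      calc _ ≤ ∫⁻ C : Fin m → Fin n → 𝒳, κ⁻¹ * ∫⁻ x, f x ∂Q ∂(codebookLaw Q d Δ m) := by
            refine lintegral_mono_ae ?_
            filter_upwards [hM m (by omega)] with C hC
            exact (lintegral_cond_le Q hC f).trans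
              (mul_le_mul_right (setLIntegral_le_lintegral _ _) _)
        _ = _ := by simp
    · simp only [Fin.snoc_castSucc]
      -- An earlier codeword does not see the last draw, whose conditional law has mass at most one.
      refine le_trans (lintegral_mono fun C => ?_) (ih (by omega) j)
      rw [lintegral_const]
      exact mul_le_of_le_one_right' prob_le_one

lemma lintegral_codeword_pair_le_of_lt (hd : Measurable fun p : 𝒳 × 𝒳 => d p.1 p.2)
    (hκ : κ ≠ 0) (hM : ∀ m < M, ∀ᵐ C ∂(codebookLaw Q d Δ m), κ ≤ Q (farSet d Δ C))
    {m : ℕ} (hm : m ≤ M) {i j : Fin m} (hij : i < j)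
    {f : (Fin n → 𝒳) → (Fin n → 𝒳) → ENNReal} (hf : Measurable (Function.uncurry f)) :
    ∫⁻ C, f (C i) (C j) ∂(codebookLaw Q d Δ m) ≤
      κ⁻¹ * κ⁻¹ * ∫⁻ x, ∫⁻ x' in {x' | Δ < avg₂ d x x'}, f x x' ∂Q ∂Q := by
  induction m with
  | zero => exact i.elim0
  | succ m ih =>
    have hfij : Measurable fun C : Fin (m + 1) → Fin n → 𝒳 => f (C i) (C j) :=
      hf.comp (f := fun C : Fin (m + 1) → Fin n → 𝒳 => (C i, C j)) (by fun_prop)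
    rw [lintegral_codebookLaw_succ Q hd Δ hfij]
    obtain ⟨i, rfl⟩ : ∃ i', i = Fin.castSucc i' :=
      ⟨i.castPred (Fin.ne_last_of_lt hij), by simp⟩
    revert hij
    refine Fin.lastCases (fun _ => ?_) (fun j hij => ?_) j
    · simp only [Fin.snoc_castSucc, Fin.snoc_last]
      have hs : MeasurableSet {p : (Fin n → 𝒳) × (Fin n → 𝒳) | Δ < avg₂ d p.1 p.2} :=
        measurableSet_lt measurable_const (measurable_avg₂ hd)
      have hF : Measurable fun x => ∫⁻ x' in {x' | Δ < avg₂ d x x'}, f x x' ∂Q := by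
        have h (x : Fin n → 𝒳) : ∫⁻ x' in {x' | Δ < avg₂ d x x'}, f x x' ∂Q =
            ∫⁻ x', {p : (Fin n → 𝒳) × (Fin n → 𝒳) | Δ < avg₂ d p.1 p.2}.indicator
              (Function.uncurry f) (x, x') ∂Q := by
          rw [← lintegral_indicator (measurableSet_far hd Δ x)]
          rfl
        simp only [h]
        exact (hf.indicator hs).lintegral_prod_right'
      calc _ ≤ ∫⁻ C : Fin m → Fin n → 𝒳,
            κ⁻¹ * ∫⁻ x' in {x' | Δ < avg₂ d (C i) x'}, f (C i) x' ∂Q ∂(codebookLaw Q d Δ m) := by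
            refine lintegral_mono_ae ?_
            filter_upwards [hM m (by omega)] with C hC
            refine (lintegral_cond_le Q hC _).trans (mul_le_mul_right ?_ _)
            -- Of all the distance constraints on the last codeword, only the one against codeword
            -- `i` is kept.
            exact lintegral_mono_set fun x hx => hx i
        _ = κ⁻¹ * ∫⁻ C : Fin m → Fin n → 𝒳,
            ∫⁻ x' in {x' | Δ < avg₂ d (C i) x'}, f (C i) x' ∂Q ∂(codebookLaw Q d Δ m) :=
            lintegral_const_mul _ (hF.comp (measurable_pi_apply i))
        _ ≤ κ⁻¹ * (κ⁻¹ * ∫⁻ x, ∫⁻ x' in {x' | Δ < avg₂ d x x'}, f x x' ∂Q ∂Q) :=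
            mul_le_mul_right (lintegral_codeword_le hd hκ hM (by omega) i hF) _
        _ = _ := by rw [mul_assoc]
    · simp only [Fin.snoc_castSucc]
      refine le_trans (lintegral_mono fun C => ?_)
        (ih (by omega) (i := i) (j := j) (by simpa using hij))
      rw [lintegral_const]
      exact mul_le_of_le_one_right' prob_le_one

lemma lintegral_codeword_pair_le (hd : Measurable fun p : 𝒳 × 𝒳 => d p.1 p.2)
    (hsymm : ∀ x x', d x x' = d x' x)
    (hκ : κ ≠ 0) (hM : ∀ m < M, ∀ᵐ C ∂(codebookLaw Q d Δ m), κ ≤ Q (farSet d Δ C))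
    {i j : Fin M} (hij : i ≠ j)
    {f : (Fin n → 𝒳) → (Fin n → 𝒳) → ENNReal} (hf : Measurable (Function.uncurry f)) :
    ∫⁻ C, f (C i) (C j) ∂(codebookLaw Q d Δ M) ≤
      κ⁻¹ * κ⁻¹ * ∫⁻ x, ∫⁻ x' in {x' | Δ < avg₂ d x x'}, f x x' ∂Q ∂Q := by
  rcases lt_or_gt_of_ne hij with h | h
  · exact lintegral_codeword_pair_le_of_lt hd hκ hM le_rfl h hf
  · refine (lintegral_codeword_pair_le_of_lt hd hκ hM le_rfl h
      (f := fun x x' => f x' x) (hf.comp measurable_swap)).trans_eq ?_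
    have hs : MeasurableSet {p : (Fin n → 𝒳) × (Fin n → 𝒳) | Δ < avg₂ d p.1 p.2} :=
      measurableSet_lt measurable_const (measurable_avg₂ hd)
    -- The draws are ordered, so for `j < i` the roles are exchanged; symmetry of `d` and Tonelli
    -- restore the stated form.
    have hdsymm (x x' : Fin n → 𝒳) : avg₂ d x x' = avg₂ d x' x := by
      simp only [avg₂, hsymm]
    have h1 (x : Fin n → 𝒳) : ∫⁻ x' in {x' | Δ < avg₂ d x x'}, f x' x ∂Q =
        ∫⁻ x', {p : (Fin n → 𝒳) × (Fin n → 𝒳) | Δ < avg₂ d p.1 p.2}.indicator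
          (fun p => f p.2 p.1) (x, x') ∂Q := by
      rw [← lintegral_indicator (measurableSet_far hd Δ x)]
      rfl
    have h2 (x : Fin n → 𝒳) : ∫⁻ x' in {x' | Δ < avg₂ d x x'}, f x x' ∂Q =
        ∫⁻ x', {p : (Fin n → 𝒳) × (Fin n → 𝒳) | Δ < avg₂ d p.1 p.2}.indicator
          (fun p => f p.2 p.1) (x', x) ∂Q := by
      rw [← lintegral_indicator (measurableSet_far hd Δ x)]
      refine lintegral_congr fun x' => ?_
      simp only [Set.indicator_apply, Set.mem_ofPred_eq, hdsymm x x']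
    simp only [h1, h2]
    rw [lintegral_lintegral_swap]
    exact ((hf.comp measurable_swap).indicator hs).aemeasurable

/-- The `Q`-probability that an independent codeword is far from `x` and beats it at output `y`. -/
noncomputable def confusionProb (q : 𝒳 → 𝒴 → ℝ) (Q : Measure (Fin n → 𝒳)) (d : 𝒳 → 𝒳 → ℝ)
    (Δ : ℝ) (x : Fin n → 𝒳) (y : Fin n → 𝒴) : ENNReal :=
  Q {x' | Δ < avg₂ d x x' ∧ avg₂ q x y ≤ avg₂ q x' y}

lemma measurableSet_confusion {q : 𝒳 → 𝒴 → ℝ} (hq : Measurable fun p : 𝒳 × 𝒴 => q p.1 p.2) :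
    MeasurableSet {p : ((Fin n → 𝒳) × (Fin n → 𝒳)) × (Fin n → 𝒴) |
      avg₂ q p.1.1 p.2 ≤ avg₂ q p.1.2 p.2} :=
  measurableSet_le
    ((measurable_avg₂ hq).comp
      (f := fun p : ((Fin n → 𝒳) × (Fin n → 𝒳)) × (Fin n → 𝒴) => (p.1.1, p.2)) (by fun_prop))
    ((measurable_avg₂ hq).comp
      (f := fun p : ((Fin n → 𝒳) × (Fin n → 𝒳)) × (Fin n → 𝒴) => (p.1.2, p.2)) (by fun_prop))

lemma measurable_confusionProb (hd : Measurable fun p : 𝒳 × 𝒳 => d p.1 p.2) {q : 𝒳 → 𝒴 → ℝ}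
    (hq : Measurable fun p : 𝒳 × 𝒴 => q p.1 p.2) :
    Measurable fun p : (Fin n → 𝒳) × (Fin n → 𝒴) => confusionProb q Q d Δ p.1 p.2 := by
  have h1 : MeasurableSet {p : ((Fin n → 𝒳) × (Fin n → 𝒴)) × (Fin n → 𝒳) |
      Δ < avg₂ d p.1.1 p.2} :=
    measurableSet_lt measurable_const
      ((measurable_avg₂ hd).comp
        (f := fun p : ((Fin n → 𝒳) × (Fin n → 𝒴)) × (Fin n → 𝒳) => (p.1.1, p.2)) (by fun_prop))
  have h2 : MeasurableSet {p : ((Fin n → 𝒳) × (Fin n → 𝒴)) × (Fin n → 𝒳) |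
      avg₂ q p.1.1 p.1.2 ≤ avg₂ q p.2 p.1.2} :=
    measurableSet_le ((measurable_avg₂ hq).comp measurable_fst)
      ((measurable_avg₂ hq).comp
        (f := fun p : ((Fin n → 𝒳) × (Fin n → 𝒴)) × (Fin n → 𝒳) => (p.2, p.1.2)) (by fun_prop))
  exact measurable_measure_prodMk_left (ν := Q) (h1.inter h2)

/-- The competitors are not independent of the sent word, so the minimum with 1 cannot come from
conditioning on that word. Instead pairs `(x, y)` are split beforehand: on `A`, where the union
bound is useless, error is bounded by 1 and only the marginal of the sent word is used; off `A`, the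
union bound needs only pair laws. -/
lemma ensembleError_le (hd : Measurable fun p : 𝒳 × 𝒳 => d p.1 p.2)
    (hsymm : ∀ x x', d x x' = d x' x) (W : Kernel 𝒳 𝒴) [IsMarkovKernel W] {q : 𝒳 → 𝒴 → ℝ}
    (hq : Measurable fun p : 𝒳 × 𝒴 => q p.1 p.2)
    (hκ : κ ≠ 0) (hκ1 : κ ≤ 1)
    (hM : ∀ m < M, ∀ᵐ C ∂(codebookLaw Q d Δ m), κ ≤ Q (farSet d Δ C)) :
    ensembleError W q Q d Δ M ≤
      κ⁻¹ * κ⁻¹ * ∫⁻ x, ∫⁻ y, min 1 (M * confusionProb q Q d Δ x y) ∂(prodChannel W n x) ∂Q := by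
  set B : ENNReal := κ⁻¹ * κ⁻¹ *
    ∫⁻ x, ∫⁻ y, min 1 (M * confusionProb q Q d Δ x y) ∂(prodChannel W n x) ∂Q with hB
  have hh := measurable_confusionProb (Δ := Δ) (Q := Q) hd hq
  have hκi : 1 ≤ κ⁻¹ := ENNReal.one_le_inv.2 hκ1
  set A : Set ((Fin n → 𝒳) × (Fin n → 𝒴)) := {p | 1 ≤ M * confusionProb q Q d Δ p.1 p.2} with hA
  have hAm : MeasurableSet A := measurableSet_le measurable_const (hh.const_mul _)
  have hwA : Measurable fun x => prodChannel W n x (Prod.mk x ⁻¹' A) :=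
    Kernel.measurable_kernel_prodMk_left hAm
  set E : Set (((Fin n → 𝒳) × (Fin n → 𝒳)) × (Fin n → 𝒴)) :=
    {p | (p.1.1, p.2) ∉ A ∧ avg₂ q p.1.1 p.2 ≤ avg₂ q p.1.2 p.2} with hE
  have hEm : MeasurableSet E :=
    (hAm.compl.preimage (f := fun p : ((Fin n → 𝒳) × (Fin n → 𝒳)) × (Fin n → 𝒴) => (p.1.1, p.2))
      (by fun_prop)).inter (measurableSet_confusion hq)
  have hwE : Measurable (Function.uncurry fun x x' : Fin n → 𝒳 =>
      prodChannel W n x {y | ((x, x'), y) ∈ E}) :=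
    Kernel.measurable_kernel_prodMk_left
      (κ := (prodChannel W n).comap (Prod.fst : (Fin n → 𝒳) × (Fin n → 𝒳) → _) measurable_fst) hEm
  have key (m : Fin M) : ∫⁻ C, (Measure.pi fun k => W (C m k))
      {y : Fin n → 𝒴 | ∃ i, i ≠ m ∧ avg₂ q (C m) y ≤ avg₂ q (C i) y} ∂(codebookLaw Q d Δ M)
      ≤ B := by
    calc _ ≤ ∫⁻ C, (prodChannel W n (C m) (Prod.mk (C m) ⁻¹' A) +
          ∑ i ∈ Finset.univ.erase m, prodChannel W n (C m) {y | ((C m, C i), y) ∈ E})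
            ∂(codebookLaw Q d Δ M) := by
          refine lintegral_mono fun C => ?_
          rw [← prodChannel_apply]
          have hsub : {y : Fin n → 𝒴 | ∃ i, i ≠ m ∧ avg₂ q (C m) y ≤ avg₂ q (C i) y} ⊆
              (Prod.mk (C m) ⁻¹' A) ∪
                ⋃ i ∈ Finset.univ.erase m, {y | ((C m, C i), y) ∈ E} := by
            rintro y ⟨i, him, hi⟩
            by_cases hy : (C m, y) ∈ A
            · exact Or.inl hy
            · refine Or.inr ?_
              simp only [Set.mem_iUnion]
              exact ⟨i, by simpa using him, hy, hi⟩
          exact (measure_mono hsub).trans ((measure_union_le _ _).trans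
            (add_le_add_right (measure_biUnion_finset_le _ _) _))
      _ = ∫⁻ C, prodChannel W n (C m) (Prod.mk (C m) ⁻¹' A) ∂(codebookLaw Q d Δ M) +
          ∑ i ∈ Finset.univ.erase m,
            ∫⁻ C, prodChannel W n (C m) {y | ((C m, C i), y) ∈ E} ∂(codebookLaw Q d Δ M) := by
          rw [lintegral_add_left (f := fun C : Fin M → Fin n → 𝒳 =>
            prodChannel W n (C m) (Prod.mk (C m) ⁻¹' A)) (hwA.comp (measurable_pi_apply m)),
            lintegral_finsetSum]
          exact fun i _ => hwE.comp (f := fun C : Fin M → Fin n → 𝒳 => (C m, C i)) (by fun_prop)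
      _ ≤ κ⁻¹ * κ⁻¹ * ∫⁻ x, prodChannel W n x (Prod.mk x ⁻¹' A) ∂Q +
          ∑ i ∈ Finset.univ.erase m, κ⁻¹ * κ⁻¹ * ∫⁻ x, ∫⁻ x' in {x' | Δ < avg₂ d x x'},
            prodChannel W n x {y | ((x, x'), y) ∈ E} ∂Q ∂Q := by
          refine add_le_add ?_ (Finset.sum_le_sum fun i hi => ?_)
          · refine (lintegral_codeword_le hd hκ hM le_rfl m hwA).trans ?_
            -- A single codeword costs only `κ⁻¹`; it is weakened to `κ⁻²` to match the pair term.
            exact mul_le_mul_left (le_mul_of_one_le_left' hκi) _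
          · exact lintegral_codeword_pair_le hd hsymm hκ hM (Finset.ne_of_mem_erase hi).symm hwE
      _ ≤ κ⁻¹ * κ⁻¹ * (∫⁻ x, prodChannel W n x (Prod.mk x ⁻¹' A) ∂Q +
          M * ∫⁻ x, ∫⁻ x' in {x' | Δ < avg₂ d x x'},
            prodChannel W n x {y | ((x, x'), y) ∈ E} ∂Q ∂Q) := by
          rw [Finset.sum_const, nsmul_eq_mul, mul_add, mul_left_comm (κ⁻¹ * κ⁻¹)]
          gcongr
          simp
      _ ≤ B := by
          rw [hB]
          refine mul_le_mul_right ?_ _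
          -- Tonelli in `(x', y)` for fixed `x`: integrating out the competitor first produces
          -- `confusionProb` off `A` and nothing on `A`.
          have h1 (x : Fin n → 𝒳) : ∫⁻ x' in {x' | Δ < avg₂ d x x'},
              prodChannel W n x {y | ((x, x'), y) ∈ E} ∂Q =
              ∫⁻ y in (Prod.mk x ⁻¹' A)ᶜ, confusionProb q Q d Δ x y ∂(prodChannel W n x) := by
            have hSm : MeasurableSet {p : (Fin n → 𝒳) × (Fin n → 𝒴) | ((x, p.1), p.2) ∈ E} :=
              hEm.preimage (f := fun p : (Fin n → 𝒳) × (Fin n → 𝒴) => ((x, p.1), p.2))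
                (by fun_prop)
            have h2 := Measure.prod_apply (μ := Q.restrict {x' | Δ < avg₂ d x x'})
              (ν := prodChannel W n x) hSm
            rw [Measure.prod_apply_symm hSm] at h2
            refine h2.symm.trans ?_
            rw [← lintegral_indicator (measurable_prodMk_left hAm).compl]
            refine lintegral_congr fun y => ?_
            rw [Measure.restrict_apply (measurable_prodMk_right hSm)]
            by_cases hy : (x, y) ∈ A
            · rw [Set.indicator_of_notMem (by simpa using hy)]
              convert measure_empty (μ := Q)
              ext x'
              simp [hE, hy]
            · rw [Set.indicator_of_mem (by simpa using hy), confusionProb]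
              congr 1
              ext x'
              simp [hE, hy, and_comm]
          simp only [h1]
          rw [← lintegral_const_mul' _ _ (ENNReal.natCast_ne_top M), ← lintegral_add_left hwA]
          refine lintegral_mono fun x => ?_
          have hAx : MeasurableSet (Prod.mk x ⁻¹' A) := measurable_prodMk_left hAm
          rw [← lintegral_add_compl (fun y => min 1 (M * confusionProb q Q d Δ x y)) hAx,
            ← lintegral_const_mul' _ _ (ENNReal.natCast_ne_top M)]
          refine add_le_add ?_ ?_
          · rw [← setLIntegral_one]
            exact setLIntegral_mono' hAx fun y hy => le_min le_rfl hy
          · exact setLIntegral_mono' hAx.compl fun y hy => 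
              le_min (not_le.1 (show ¬ 1 ≤ M * confusionProb q Q d Δ x y from hy)).le le_rfl
  unfold ensembleError errorProb
  simp only [div_eq_mul_inv]
  rw [lintegral_mul_const _ (Finset.measurable_sum _ fun m _ => measurable_wordError W hq m),
    lintegral_finsetSum _ fun m _ => measurable_wordError W hq m, ← div_eq_mul_inv]
  refine ENNReal.div_le_of_le_mul ((Finset.sum_le_sum fun m _ => key m).trans_eq ?_)
  rw [Finset.sum_const, nsmul_eq_mul, Finset.card_univ, Fintype.card_fin, mul_comm]

end Codebook

/-! ### Chernoff bounds in terms of the single-letter costs. -/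

section Chernoff

variable {𝒳 𝒴 : Type*} [MeasurableSpace 𝒳] [MeasurableSpace 𝒴]

lemma avg_mul {α : Type*} {n : ℕ} (f : α → ℝ) (x : Fin n → α) : avg f x * n = ∑ k, f (x k) := by
  rcases Nat.eq_zero_or_pos n with rfl | hn
  · simp
  · rw [avg, div_mul_cancel₀]
    positivity

lemma avg₂_mul {α β : Type*} {n : ℕ} (f : α → β → ℝ) (x : Fin n → α) (y : Fin n → β) :
    avg₂ f x y * n = ∑ k, f (x k) (y k) := by
  rcases Nat.eq_zero_or_pos n with rfl | hn
  · simp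
  · rw [avg₂, div_mul_cancel₀]
    positivity

lemma prod_ofReal_exp {n : ℕ} (f : Fin n → ℝ) :
    ∏ k, ENNReal.ofReal (Real.exp (f k)) = ENNReal.ofReal (Real.exp (∑ k, f k)) := by
  rw [Real.exp_sum, ENNReal.ofReal_prod_of_nonneg fun _ _ => (Real.exp_pos _).le]

lemma one_le_ofReal_exp {t : ℝ} (ht : 0 ≤ t) : 1 ≤ ENNReal.ofReal (Real.exp t) := by
  rw [ENNReal.one_le_ofReal]
  exact Real.one_le_exp ht

/-- Inverts the definition of the costs. Both exclusions matter, because `toReal` sends `⊤` and `0`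
to the same value. -/
lemma eq_ofReal_exp_neg_neg_log {z : ENNReal} (h0 : z ≠ 0) (ht : z ≠ ⊤) :
    z = ENNReal.ofReal (Real.exp (- -Real.log z.toReal)) := by
  rw [neg_neg, Real.exp_log (ENNReal.toReal_pos h0 ht), ENNReal.ofReal_toReal ht]

lemma lintegral_ne_zero_of_pos {α : Type*} [MeasurableSpace α] {μ : Measure α}
    [IsProbabilityMeasure μ] {f : α → ENNReal} (hf : Measurable f) (hpos : ∀ x, f x ≠ 0) :
    ∫⁻ x, f x ∂μ ≠ 0 := by
  rw [Ne, lintegral_eq_zero_iff hf]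
  intro h
  obtain ⟨x, hx⟩ := h.exists
  exact hpos x hx

lemma min_one_le_rpow (z : ENNReal) {ρ : ℝ} (h0 : 0 ≤ ρ) (h1 : ρ ≤ 1) : min 1 z ≤ z ^ ρ := by
  rcases le_total z 1 with h | h
  · refine (min_le_right _ _).trans ?_
    simpa using ENNReal.rpow_le_rpow_of_exponent_ge h h1
  · refine (min_le_left _ _).trans ?_
    simpa using ENNReal.rpow_le_rpow h h0

variable {P : Measure 𝒳} [IsProbabilityMeasure P]

lemma measurable_rate_integrand {d : 𝒳 → 𝒳 → ℝ} (hd : Measurable fun p : 𝒳 × 𝒳 => d p.1 p.2)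
    (Δ r φ : ℝ) {a : 𝒳 → ℝ} (ha : Measurable a) :
    Measurable fun p : 𝒳 × 𝒳 => ENNReal.ofReal
      (Real.exp (a p.2 - φ) * Real.exp (-r * (d p.1 p.2 - Δ))) := by
  fun_prop

lemma rateMoment_eq_exp {d : 𝒳 → 𝒳 → ℝ} (hd : Measurable fun p : 𝒳 × 𝒳 => d p.1 p.2)
    {Δ r : ℝ} {a : 𝒳 → ℝ} (ha : Measurable a) {x : 𝒳} (hx : rateMoment P d Δ r a x ≠ ⊤) :
    rateMoment P d Δ r a x = ENNReal.ofReal (Real.exp (-rateCost P d Δ r a x)) := by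
  refine eq_ofReal_exp_neg_neg_log (lintegral_ne_zero_of_pos ?_ fun x' => ?_) hx
  · exact (measurable_rate_integrand hd Δ r _ ha).comp measurable_prodMk_left
  · simp only [Ne, ENNReal.ofReal_eq_zero, not_le]
    positivity

lemma measurable_rateMoment {d : 𝒳 → 𝒳 → ℝ} (hd : Measurable fun p : 𝒳 × 𝒳 => d p.1 p.2)
    (Δ r : ℝ) {a : 𝒳 → ℝ} (ha : Measurable a) : Measurable (rateMoment P d Δ r a) :=
  (measurable_rate_integrand hd Δ r _ ha).lintegral_prod_right'

lemma measurable_rateCost {d : 𝒳 → 𝒳 → ℝ} (hd : Measurable fun p : 𝒳 × 𝒳 => d p.1 p.2)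
    (Δ r : ℝ) {a : 𝒳 → ℝ} (ha : Measurable a) : Measurable (rateCost P d Δ r a) :=
  (Real.measurable_log.comp (measurable_rateMoment hd Δ r ha).ennreal_toReal).neg

lemma measurable_exp_integrand {q : 𝒳 → 𝒴 → ℝ} (hq : Measurable fun p : 𝒳 × 𝒴 => q p.1 p.2)
    {d : 𝒳 → 𝒳 → ℝ} (hd : Measurable fun p : 𝒳 × 𝒳 => d p.1 p.2)
    (Δ r s : ℝ) {a : 𝒳 → ℝ} (ha : Measurable a) :
    Measurable fun p : (𝒳 × 𝒴) × 𝒳 => ENNReal.ofReal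
      (Real.exp (s * q p.2 p.1.2) * Real.exp (a p.2) * Real.exp (r * (d p.1.1 p.2 - Δ))) := by
  have h1 : Measurable fun p : (𝒳 × 𝒴) × 𝒳 => q p.2 p.1.2 :=
    hq.comp (f := fun p : (𝒳 × 𝒴) × 𝒳 => (p.2, p.1.2)) (by fun_prop)
  have h2 : Measurable fun p : (𝒳 × 𝒴) × 𝒳 => d p.1.1 p.2 :=
    hd.comp (f := fun p : (𝒳 × 𝒴) × 𝒳 => (p.1.1, p.2)) (by fun_prop)
  fun_prop

/-- The likelihood-type ratio whose `ρ`-th moment under the channel is `expMoment`. -/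
noncomputable def expRatio (P : Measure 𝒳) (q : 𝒳 → 𝒴 → ℝ) (d : 𝒳 → 𝒳 → ℝ) (Δ r s : ℝ)
    (a : 𝒳 → ℝ) (x : 𝒳) (y : 𝒴) : ENNReal :=
  (∫⁻ x', ENNReal.ofReal
      (Real.exp (s * q x' y) * Real.exp (a x') * Real.exp (r * (d x x' - Δ))) ∂P)
    / ENNReal.ofReal (Real.exp (s * q x y) * Real.exp (a x))

lemma measurable_expRatio {q : 𝒳 → 𝒴 → ℝ} (hq : Measurable fun p : 𝒳 × 𝒴 => q p.1 p.2)
    {d : 𝒳 → 𝒳 → ℝ} (hd : Measurable fun p : 𝒳 × 𝒳 => d p.1 p.2)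
    (Δ r s : ℝ) {a : 𝒳 → ℝ} (ha : Measurable a) :
    Measurable fun p : 𝒳 × 𝒴 => expRatio P q d Δ r s a p.1 p.2 := by
  refine Measurable.div (measurable_exp_integrand hq hd Δ r s ha).lintegral_prod_right' ?_
  fun_prop

lemma expRatio_ne_zero {q : 𝒳 → 𝒴 → ℝ} (hq : Measurable fun p : 𝒳 × 𝒴 => q p.1 p.2)
    {d : 𝒳 → 𝒳 → ℝ} (hd : Measurable fun p : 𝒳 × 𝒳 => d p.1 p.2)
    (Δ r s : ℝ) {a : 𝒳 → ℝ} (ha : Measurable a) (x : 𝒳) (y : 𝒴) :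
    expRatio P q d Δ r s a x y ≠ 0 := by
  refine (ENNReal.div_pos (lintegral_ne_zero_of_pos ?_ fun x' => ?_) ENNReal.ofReal_ne_top).ne'
  · exact (measurable_exp_integrand hq hd Δ r s ha).comp
      (f := fun x' : 𝒳 => ((x, y), x')) measurable_prodMk_left
  · simp only [Ne, ENNReal.ofReal_eq_zero, not_le]
    positivity

omit [MeasurableSpace 𝒴] [IsProbabilityMeasure P] in
lemma expRatio_eq_lintegral (q : 𝒳 → 𝒴 → ℝ) (d : 𝒳 → 𝒳 → ℝ) (Δ r s : ℝ)
    (a : 𝒳 → ℝ) (x : 𝒳) (y : 𝒴) :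
    expRatio P q d Δ r s a x y = ∫⁻ x', ENNReal.ofReal
      (Real.exp (s * (q x' y - q x y) + (a x' - a x) + r * (d x x' - Δ))) ∂P := by
  have hpos : 0 < Real.exp (s * q x y) * Real.exp (a x) := by positivity
  rw [expRatio, div_eq_mul_inv, ← lintegral_mul_const']
  · refine lintegral_congr fun x' => ?_
    rw [← div_eq_mul_inv, ← ENNReal.ofReal_div_of_pos hpos]
    congr 1
    simp only [← Real.exp_add, ← Real.exp_sub]
    congr 1
    ring
  · simp only [Ne, ENNReal.inv_eq_top, ENNReal.ofReal_eq_zero, not_le]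
    exact hpos

lemma measurable_expRatio_pow_right {q : 𝒳 → 𝒴 → ℝ}
    (hq : Measurable fun p : 𝒳 × 𝒴 => q p.1 p.2)
    {d : 𝒳 → 𝒳 → ℝ} (hd : Measurable fun p : 𝒳 × 𝒳 => d p.1 p.2)
    (Δ r s : ℝ) {a : 𝒳 → ℝ} (ha : Measurable a) (ρ : ℝ) (x : 𝒳) :
    Measurable fun y : 𝒴 => expRatio P q d Δ r s a x y ^ ρ := by
  have h : Measurable fun y : 𝒴 => expRatio P q d Δ r s a x y :=
    (measurable_expRatio hq hd Δ r s ha).comp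
      (g := fun p : 𝒳 × 𝒴 => expRatio P q d Δ r s a p.1 p.2) (f := fun y : 𝒴 => (x, y))
      measurable_prodMk_left
  exact h.pow_const ρ

variable {W : Kernel 𝒳 𝒴} [IsMarkovKernel W]

omit [IsMarkovKernel W] [IsProbabilityMeasure P] in
lemma expMoment_eq_lintegral (q : 𝒳 → 𝒴 → ℝ) (d : 𝒳 → 𝒳 → ℝ) (Δ ρ r s : ℝ)
    (a : 𝒳 → ℝ) (x : 𝒳) : expMoment P W q d Δ ρ r s a x =
      ∫⁻ y, expRatio P q d Δ r s a x y ^ ρ ∂(W x) := rfl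

lemma measurable_expMoment {q : 𝒳 → 𝒴 → ℝ} (hq : Measurable fun p : 𝒳 × 𝒴 => q p.1 p.2)
    {d : 𝒳 → 𝒳 → ℝ} (hd : Measurable fun p : 𝒳 × 𝒳 => d p.1 p.2)
    (Δ ρ r s : ℝ) {a : 𝒳 → ℝ} (ha : Measurable a) :
    Measurable (expMoment P W q d Δ ρ r s a) :=
  Measurable.lintegral_kernel_prod_right (κ := W)
    (f := fun x y => expRatio P q d Δ r s a x y ^ ρ)
    ((measurable_expRatio hq hd Δ r s ha).pow_const ρ)

lemma measurable_expCost {q : 𝒳 → 𝒴 → ℝ} (hq : Measurable fun p : 𝒳 × 𝒴 => q p.1 p.2)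
    {d : 𝒳 → 𝒳 → ℝ} (hd : Measurable fun p : 𝒳 × 𝒳 => d p.1 p.2)
    (Δ ρ r s : ℝ) {a : 𝒳 → ℝ} (ha : Measurable a) :
    Measurable (expCost P W q d Δ ρ r s a) :=
  (Real.measurable_log.comp (measurable_expMoment hq hd Δ ρ r s ha).ennreal_toReal).neg

lemma expMoment_eq_exp {q : 𝒳 → 𝒴 → ℝ} (hq : Measurable fun p : 𝒳 × 𝒴 => q p.1 p.2)
    {d : 𝒳 → 𝒳 → ℝ} (hd : Measurable fun p : 𝒳 × 𝒳 => d p.1 p.2)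
    {Δ ρ r s : ℝ} (hρ : 0 ≤ ρ) {a : 𝒳 → ℝ} (ha : Measurable a) {x : 𝒳}
    (hx : expMoment P W q d Δ ρ r s a x ≠ ⊤) :
    expMoment P W q d Δ ρ r s a x =
      ENNReal.ofReal (Real.exp (-expCost P W q d Δ ρ r s a x)) := by
  refine eq_ofReal_exp_neg_neg_log ?_ hx
  rw [expMoment_eq_lintegral]
  refine lintegral_ne_zero_of_pos (measurable_expRatio_pow_right hq hd Δ r s ha ρ x) fun y => ?_
  rw [Ne, ENNReal.rpow_eq_zero_iff]
  rintro (⟨h, -⟩ | ⟨-, h⟩)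
  · exact expRatio_ne_zero hq hd Δ r s ha x y h
  -- The ratio may be infinite, but an infinite value has a vanishing power only for negative
  -- exponents.
  · exact hρ.not_gt h

variable {n : ℕ}

omit [IsProbabilityMeasure P] in
lemma cond_le_two_mul {S : Set (Fin n → 𝒳)} (hS : MeasurableSet S)
    (hhalf : 2⁻¹ ≤ Measure.pi (fun _ => P) S) (T : Set (Fin n → 𝒳)) :
    ProbabilityTheory.cond (Measure.pi fun _ => P) S T ≤
      2 * Measure.pi (fun _ => P) (S ∩ T) := by
  rw [cond_apply hS]
  gcongr
  exact ENNReal.inv_le_iff_inv_le.1 hhalf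

/-- Chernoff bound with tilt `a - φ` and multiplier `r` on the distance. One `ε` pays for the
fluctuation of `a` at the new word, the other for that of `rateCost` at the given word; the factor 2
is the conditioning on `S`. -/
lemma cond_near_le {S : Set (Fin n → 𝒳)} (hS : MeasurableSet S)
    (hhalf : 2⁻¹ ≤ Measure.pi (fun _ => P) S)
    {d : 𝒳 → 𝒳 → ℝ} (hd : Measurable fun p : 𝒳 × 𝒳 => d p.1 p.2) {Δ r ε : ℝ} {a : 𝒳 → ℝ}
    (hr : 0 ≤ r) (ha : Measurable a)
    (hSa : ∀ x ∈ S, |avg a x - ∫ z, a z ∂P| ≤ ε)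
    {x : Fin n → 𝒳} (hx : |avg (rateCost P d Δ r a) x - ∫ z, rateCost P d Δ r a z ∂P| ≤ ε)
    (hfin : ∀ k, rateMoment P d Δ r a (x k) ≠ ⊤) :
    ProbabilityTheory.cond (Measure.pi fun _ => P) S {x' | avg₂ d x x' ≤ Δ} ≤
      ENNReal.ofReal (2 * Real.exp (n * (2 * ε - rateValue P d Δ r a))) := by
  set φ := ∫ z, a z ∂P with hφ
  have hT : MeasurableSet {x' | avg₂ d x x' ≤ Δ} :=
    measurableSet_le ((measurable_avg₂ hd).comp measurable_prodMk_left) measurable_const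
  have hpt : ∀ x' ∈ S ∩ {x' | avg₂ d x x' ≤ Δ}, 1 ≤ ENNReal.ofReal (Real.exp (n * ε)) *
      ∏ k, ENNReal.ofReal (Real.exp (a (x' k) - φ) * Real.exp (-r * (d (x k) (x' k) - Δ))) := by
    rintro x' ⟨hx'S, hx'T : avg₂ d x x' ≤ Δ⟩
    simp only [← Real.exp_add]
    rw [prod_ofReal_exp, ← ENNReal.ofReal_mul (Real.exp_pos _).le, ← Real.exp_add]
    refine one_le_ofReal_exp ?_
    have h1 : ∑ k, ((a (x' k) - φ) + -r * (d (x k) (x' k) - Δ)) =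
        n * (avg a x' - φ) + r * n * (Δ - avg₂ d x x') := by
      have e1 := avg_mul a x'
      have e2 := avg₂_mul d x x'
      simp only [Finset.sum_add_distrib, Finset.sum_sub_distrib, ← Finset.mul_sum,
        Finset.sum_const, Finset.card_univ, Fintype.card_fin, nsmul_eq_mul]
      rw [← e1, ← e2]
      ring
    rw [h1]
    have h2 := (abs_le.1 (hSa x' hx'S)).1
    have h3 : 0 ≤ (n : ℝ) * (ε + (avg a x' - φ)) := mul_nonneg n.cast_nonneg (by linarith)
    have h4 : 0 ≤ r * n * (Δ - avg₂ d x x') := mul_nonneg (by positivity) (by linarith)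
    linarith
  calc _ ≤ 2 * Measure.pi (fun _ => P) (S ∩ {x' | avg₂ d x x' ≤ Δ}) := cond_le_two_mul hS hhalf _
    _ ≤ 2 * ∫⁻ x', ENNReal.ofReal (Real.exp (n * ε)) * ∏ k, ENNReal.ofReal
          (Real.exp (a (x' k) - φ) * Real.exp (-r * (d (x k) (x' k) - Δ)))
            ∂(Measure.pi fun _ => P) := by
        gcongr
        rw [← setLIntegral_one]
        exact (setLIntegral_mono' (hS.inter hT) hpt).trans (setLIntegral_le_lintegral _ _)
    _ = 2 * (ENNReal.ofReal (Real.exp (n * ε)) * ∏ k, rateMoment P d Δ r a (x k)) := by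
        rw [lintegral_const_mul' _ _ ENNReal.ofReal_ne_top,
          lintegral_pi_prod (fun _ : Fin n => P) (f := fun k x' => ENNReal.ofReal
            (Real.exp (a x' - φ) * Real.exp (-r * (d (x k) x' - Δ))))]
        · rfl
        · exact fun k => (measurable_rate_integrand hd Δ r φ ha).comp measurable_prodMk_left
    _ ≤ _ := by
        simp only [rateMoment_eq_exp hd ha (hfin _)]
        rw [prod_ofReal_exp, ← ENNReal.ofReal_mul (Real.exp_pos _).le, ← Real.exp_add,
          ENNReal.ofReal_mul zero_le_two, ENNReal.ofReal_ofNat, Finset.sum_neg_distrib,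
          ← avg_mul]
        gcongr
        have h2 := (abs_le.1 hx).1
        rw [rateValue]
        have : 0 ≤ (n : ℝ) *
          (ε + (avg (rateCost P d Δ r a) x - ∫ z, rateCost P d Δ r a z ∂P)) :=
          mul_nonneg n.cast_nonneg (by linarith)
        linarith

/-- Here the tilt is the difference of `a` at the two words, so the mean of `a` cancels and each
word contributes one `ε`. The metric and distance terms are nonnegative on the confusion event. -/
lemma confusionProb_le {S : Set (Fin n → 𝒳)} (hS : MeasurableSet S)
    (hhalf : 2⁻¹ ≤ Measure.pi (fun _ => P) S)
    {q : 𝒳 → 𝒴 → ℝ} (hq : Measurable fun p : 𝒳 × 𝒴 => q p.1 p.2)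
    {d : 𝒳 → 𝒳 → ℝ} (hd : Measurable fun p : 𝒳 × 𝒳 => d p.1 p.2) {Δ r s ε : ℝ} {a : 𝒳 → ℝ}
    (hr : 0 ≤ r) (hs : 0 ≤ s) (ha : Measurable a)
    (hSa : ∀ x ∈ S, |avg a x - ∫ z, a z ∂P| ≤ ε) {x : Fin n → 𝒳} (hx : x ∈ S)
    (y : Fin n → 𝒴) :
    confusionProb q (ProbabilityTheory.cond (Measure.pi fun _ => P) S) d Δ x y ≤
      ENNReal.ofReal (2 * Real.exp (2 * n * ε)) *
        ∏ k, expRatio P q d Δ r s a (x k) (y k) := by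
  set T : Set (Fin n → 𝒳) := {x' | Δ < avg₂ d x x' ∧ avg₂ q x y ≤ avg₂ q x' y} with hT
  have hTm : MeasurableSet T :=
    (measurableSet_far hd Δ x).inter
      (measurableSet_le measurable_const ((measurable_avg₂ hq).comp measurable_prodMk_right))
  have hpt : ∀ x' ∈ S ∩ T, 1 ≤ ENNReal.ofReal (Real.exp (2 * n * ε)) *
      ∏ k, ENNReal.ofReal (Real.exp (s * (q (x' k) (y k) - q (x k) (y k)) +
        (a (x' k) - a (x k)) + r * (d (x k) (x' k) - Δ))) := by
    rintro x' ⟨hx'S, hx'd, hx'q⟩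
    rw [prod_ofReal_exp, ← ENNReal.ofReal_mul (Real.exp_pos _).le, ← Real.exp_add]
    refine one_le_ofReal_exp ?_
    have h1 : ∑ k, (s * (q (x' k) (y k) - q (x k) (y k)) +
        (a (x' k) - a (x k)) + r * (d (x k) (x' k) - Δ)) =
        s * n * (avg₂ q x' y - avg₂ q x y) + n * (avg a x' - avg a x)
          + r * n * (avg₂ d x x' - Δ) := by
      have e1 := avg_mul a x'
      have e2 := avg_mul a x
      have e3 := avg₂_mul d x x'
      have e4 := avg₂_mul q x' y
      have e5 := avg₂_mul q x y
      simp only [Finset.sum_add_distrib, Finset.sum_sub_distrib, ← Finset.mul_sum,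
        Finset.sum_const, Finset.card_univ, Fintype.card_fin, nsmul_eq_mul]
      rw [← e1, ← e2, ← e3, ← e4, ← e5]
      ring
    rw [h1]
    have h2 := (abs_le.1 (hSa x' hx'S)).1
    have h2' := (abs_le.1 (hSa x hx)).2
    have h3 : 0 ≤ (n : ℝ) * (2 * ε + (avg a x' - avg a x)) :=
      mul_nonneg n.cast_nonneg (by linarith)
    have h4 : 0 ≤ r * n * (avg₂ d x x' - Δ) := mul_nonneg (by positivity) (by linarith)
    have h5 : 0 ≤ s * n * (avg₂ q x' y - avg₂ q x y) := mul_nonneg (by positivity) (by linarith)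
    linarith
  calc _ ≤ 2 * Measure.pi (fun _ => P) (S ∩ T) := cond_le_two_mul hS hhalf _
    _ ≤ 2 * ∫⁻ x', ENNReal.ofReal (Real.exp (2 * n * ε)) * ∏ k, ENNReal.ofReal
          (Real.exp (s * (q (x' k) (y k) - q (x k) (y k)) +
            (a (x' k) - a (x k)) + r * (d (x k) (x' k) - Δ))) ∂(Measure.pi fun _ => P) := by
        gcongr
        rw [← setLIntegral_one]
        exact (setLIntegral_mono' (hS.inter hTm) hpt).trans (setLIntegral_le_lintegral _ _)
    _ = _ := by
        simp only [expRatio_eq_lintegral]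
        rw [lintegral_const_mul' _ _ ENNReal.ofReal_ne_top,
          lintegral_pi_prod (fun _ : Fin n => P) (f := fun k x' => ENNReal.ofReal
            (Real.exp (s * (q x' (y k) - q (x k) (y k)) +
              (a x' - a (x k)) + r * (d (x k) x' - Δ)))),
          ENNReal.ofReal_mul zero_le_two, ENNReal.ofReal_ofNat, ← mul_assoc]
        intro k
        have h1 : Measurable fun x' => q x' (y k) := hq.comp measurable_prodMk_right
        have h2 : Measurable fun x' => d (x k) x' := hd.comp measurable_prodMk_left
        fun_prop

lemma lintegral_min_confusionProb_le {S : Set (Fin n → 𝒳)} (hS : MeasurableSet S)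
    (hhalf : 2⁻¹ ≤ Measure.pi (fun _ => P) S)
    {q : 𝒳 → 𝒴 → ℝ} (hq : Measurable fun p : 𝒳 × 𝒴 => q p.1 p.2)
    {d : 𝒳 → 𝒳 → ℝ} (hd : Measurable fun p : 𝒳 × 𝒳 => d p.1 p.2) {Δ ρ r s ε : ℝ} {a : 𝒳 → ℝ}
    (hpar : ExpParams P W q d Δ ρ r s a) (hε : 0 ≤ ε)
    (hSa : ∀ x ∈ S, |avg a x - ∫ z, a z ∂P| ≤ ε) {x : Fin n → 𝒳} (hx : x ∈ S)
    (hxc : |avg (expCost P W q d Δ ρ r s a) x - ∫ z, expCost P W q d Δ ρ r s a z ∂P| ≤ ε)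
    (hfin : ∀ k, expMoment P W q d Δ ρ r s a (x k) ≠ ⊤)
    {M : ℕ} {R : ℝ} (hM : (M : ℝ) ≤ Real.exp (n * R)) :
    ∫⁻ y, min 1 (M * confusionProb q (ProbabilityTheory.cond (Measure.pi fun _ => P) S) d Δ x y)
      ∂(prodChannel W n x) ≤
      ENNReal.ofReal (2 * Real.exp (n * (3 * ε - expValue P W q d Δ R ρ r s a))) := by
  have ha := hpar.measurable
  have hρ := hpar.ρ_nonneg
  set K : ENNReal := ENNReal.ofReal (Real.exp (n * R)) *
    ENNReal.ofReal (2 * Real.exp (2 * n * ε)) with hK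
  have hKρ : K ^ ρ ≤ ENNReal.ofReal (2 * Real.exp (n * (ρ * R + 2 * ε))) := by
    -- A constant at least 1 does not grow under a power `ρ ≤ 1`, so `ρ` need multiply only `R`.
    have h2 : 1 ≤ 2 * Real.exp (2 * n * ε) := by
      have : 1 ≤ Real.exp (2 * n * ε) := Real.one_le_exp (by positivity)
      linarith
    rw [hK, ENNReal.mul_rpow_of_nonneg _ _ hρ, ENNReal.ofReal_rpow_of_pos (Real.exp_pos _),
      ← Real.exp_mul]
    calc _ ≤ ENNReal.ofReal (Real.exp (n * R * ρ)) * ENNReal.ofReal (2 * Real.exp (2 * n * ε)) := by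
          gcongr
          simpa using
            ENNReal.rpow_le_rpow_of_exponent_le (ENNReal.one_le_ofReal.2 h2) hpar.ρ_le_one
      _ = _ := by
          rw [← ENNReal.ofReal_mul (Real.exp_pos _).le, mul_left_comm, ← Real.exp_add]
          congr 3
          ring
  calc _ ≤ ∫⁻ y, K ^ ρ * ∏ k, expRatio P q d Δ r s a (x k) (y k) ^ ρ
          ∂(prodChannel W n x) := by
        refine lintegral_mono fun y => (min_one_le_rpow _ hρ hpar.ρ_le_one).trans ?_
        rw [ENNReal.prod_rpow_of_nonneg hρ, ← ENNReal.mul_rpow_of_nonneg _ _ hρ, hK, mul_assoc]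
        gcongr
        · rw [← ENNReal.ofReal_natCast]
          exact ENNReal.ofReal_le_ofReal hM
        · exact confusionProb_le hS hhalf hq hd hpar.r_nonneg hpar.s_nonneg ha hSa hx y
    _ = K ^ ρ * ∏ k, expMoment P W q d Δ ρ r s a (x k) := by
        rw [lintegral_const_mul' _ _ (hKρ.trans_lt ENNReal.ofReal_lt_top).ne, prodChannel_apply,
          lintegral_pi_prod (fun k : Fin n => W (x k))
            (f := fun k y => expRatio P q d Δ r s a (x k) y ^ ρ)]
        · simp only [expMoment_eq_lintegral]
        · exact fun k => measurable_expRatio_pow_right hq hd Δ r s ha ρ (x k)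
    _ ≤ ENNReal.ofReal (2 * Real.exp (n * (ρ * R + 2 * ε))) *
          ENNReal.ofReal (Real.exp (-∑ k, expCost P W q d Δ ρ r s a (x k))) := by
        simp only [expMoment_eq_exp hq hd hρ ha (hfin _)]
        rw [prod_ofReal_exp, Finset.sum_neg_distrib]
        gcongr
    _ ≤ _ := by
        rw [← ENNReal.ofReal_mul (by positivity), mul_assoc, ← Real.exp_add, ← avg_mul]
        gcongr
        -- The third `ε`: the empirical mean of `expCost` replaced by its expectation.
        have h2 := (abs_le.1 hxc).1
        rw [expValue]
        have : 0 ≤ (n : ℝ) * (ε + (avg (expCost P W q d Δ ρ r s a) x -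
            ∫ z, expCost P W q d Δ ρ r s a z ∂P)) :=
          mul_nonneg n.cast_nonneg (by linarith)
        linarith

end Chernoff

/-! ### The constraint set is typical. -/

section LawOfLargeNumbers

variable {𝒳 : Type*} [MeasurableSpace 𝒳] {P : Measure 𝒳} [IsProbabilityMeasure P]

lemma infinitePi_map_fin (P : Measure 𝒳) [IsProbabilityMeasure P] (n : ℕ) :
    (Measure.infinitePi fun _ : ℕ => P).map (fun ω (k : Fin n) => ω k) =
      Measure.pi fun _ : Fin n => P := by
  have h := (iIndepFun_infinitePi (P := fun _ : ℕ => P) (X := fun _ x => x)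
    fun _ => measurable_id).precomp (g := fun k : Fin n => (k : ℕ)) Fin.val_injective
  rw [iIndepFun_iff_map_fun_eq_pi_map fun k => (measurable_pi_apply _).aemeasurable] at h
  refine h.trans ?_
  congr 1
  ext1 k
  exact Measure.infinitePi_map_eval (fun _ : ℕ => P) k

/-- The costs are only integrable, so Chebyshev is unavailable. The strong law on the infinite
product gives convergence in measure, which is then read on the first `n` coordinates. -/
lemma tendsto_avg_ge {f : 𝒳 → ℝ} (hf : Measurable f) (hint : Integrable f P) {ε : ℝ}
    (hε : 0 < ε) :
    Tendsto (fun n : ℕ => Measure.pi (fun _ : Fin n => P)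
      {x | ε ≤ |avg f x - ∫ z, f z ∂P|}) atTop (nhds 0) := by
  set μ := Measure.infinitePi fun _ : ℕ => P with hμ
  have hmap (i : ℕ) : μ.map (fun ω => ω i) = P := Measure.infinitePi_map_eval (fun _ : ℕ => P) i
  have hX (i : ℕ) : Measurable fun ω : ℕ → 𝒳 => f (ω i) := hf.comp (measurable_pi_apply i)
  have hint0 : Integrable (fun ω : ℕ → 𝒳 => f (ω 0)) μ := by
    refine Integrable.comp_measurable (f := fun ω : ℕ → 𝒳 => ω 0) ?_ (measurable_pi_apply 0)
    rwa [hmap]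
  have hmean : ∫ ω, f (ω 0) ∂μ = ∫ z, f z ∂P := by
    rw [← hmap 0, integral_map (measurable_pi_apply 0).aemeasurable
      hf.aestronglyMeasurable]
  have hslln := strong_law_ae_real (μ := μ) (fun i ω => f (ω i)) hint0
    (fun i j hij => (iIndepFun_infinitePi (P := fun _ : ℕ => P) (X := fun _ => f)
      fun _ => hf).indepFun hij)
    (fun i => by
      refine ⟨(hX i).aemeasurable, (hX 0).aemeasurable, ?_⟩
      have e (j : ℕ) : μ.map (fun ω => f (ω j)) = P.map f := by
        rw [← hmap j, Measure.map_map hf (measurable_pi_apply j)]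
        rfl
      rw [e, e])
  rw [hmean] at hslln
  have htm := tendstoInMeasure_of_tendsto_ae
    (fun n => (Measurable.div_const (Finset.measurable_sum (Finset.range n) fun i _ => hX i)
      (n : ℝ)).aestronglyMeasurable) hslln
  rw [tendstoInMeasure_iff_dist] at htm
  refine (htm ε hε).congr fun n => ?_
  rw [← infinitePi_map_fin P n, Measure.map_apply (by fun_prop)]
  · simp only [Real.dist_eq, avg, Set.preimage_ofPred_eq, Finset.sum_range]
    rfl
  · exact measurableSet_le measurable_const ((measurable_avg hf).sub_const _).abs

lemma eventually_half_le_costSet {J L : ℕ} {a : Fin J → 𝒳 → ℝ} (ha : ∀ j, Measurable (a j))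
    (haint : ∀ j, Integrable (a j) P) {ε : ℝ} (hε : 0 < ε) {c : Fin L → 𝒳 → ℝ}
    {Γ : Fin L → ℝ} (hc : ∀ l, Measurable (c l)) (hcint : ∀ l, Integrable (c l) P)
    (hcΓ : ∀ l, ∫ x, c l x ∂P < Γ l) :
    ∀ᶠ n : ℕ in atTop, 2⁻¹ ≤ Measure.pi (fun _ : Fin n => P) (costSet P a ε c Γ n) := by
  have hlim : Tendsto (fun n : ℕ =>
      ∑ j, Measure.pi (fun _ : Fin n => P) {x | ε ≤ |avg (a j) x - ∫ z, a j z ∂P|} +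
      ∑ l, Measure.pi (fun _ : Fin n => P)
        {x | Γ l - ∫ z, c l z ∂P ≤ |avg (c l) x - ∫ z, c l z ∂P|}) atTop (nhds 0) := by
    have h := (tendsto_finsetSum Finset.univ fun j _ => tendsto_avg_ge (ha j) (haint j) hε).add
      (tendsto_finsetSum Finset.univ fun l _ =>
        tendsto_avg_ge (hc l) (hcint l) (sub_pos.2 (hcΓ l)))
    simpa using h
  filter_upwards [hlim.eventually_le_const (show (0 : ENNReal) < 2⁻¹ by simp)] with n hn
  have hS := measurableSet_costSet P ha ε hc Γ n
  have hsub : (costSet P a ε c Γ n)ᶜ ⊆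
      (⋃ j, {x | ε ≤ |avg (a j) x - ∫ z, a j z ∂P|}) ∪
      ⋃ l, {x | Γ l - ∫ z, c l z ∂P ≤ |avg (c l) x - ∫ z, c l z ∂P|} := by
    intro x hx
    -- Violating a system constraint forces a deviation above the positive gap between `Γ l` and the
    -- mean cost.
    by_contra hcon
    simp only [Set.mem_union, Set.mem_iUnion, Set.mem_ofPred_eq, not_or, not_exists, not_le]
      at hcon
    refine hx ⟨fun j => (hcon.1 j).le, fun l => ?_⟩
    have := (abs_lt.1 (hcon.2 l)).2
    linarith
  have hcompl : Measure.pi (fun _ : Fin n => P) (costSet P a ε c Γ n)ᶜ ≤ 2⁻¹ := by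
    refine (measure_mono hsub).trans ((measure_union_le _ _).trans (le_trans ?_ hn))
    exact add_le_add (measure_iUnion_fintype_le _ _) (measure_iUnion_fintype_le _ _)
  have htot := prob_add_prob_compl (μ := Measure.pi fun _ : Fin n => P) hS
  by_contra! hlt
  have : Measure.pi (fun _ : Fin n => P) (costSet P a ε c Γ n) +
      Measure.pi (fun _ : Fin n => P) (costSet P a ε c Γ n)ᶜ < 2⁻¹ + 2⁻¹ :=
    ENNReal.add_lt_add_of_lt_of_le (by finiteness) hlt hcompl
  rw [htot, ENNReal.inv_two_add_inv_two] at this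
  exact lt_irrefl _ this

end LawOfLargeNumbers

/-! ### Assembling the ensemble bound and extracting codebooks. -/

section RandomCoding

variable {𝒳 𝒴 : Type*} [MeasurableSpace 𝒳] [MeasurableSpace 𝒴]
  {P : Measure 𝒳} [IsProbabilityMeasure P] {W : Kernel 𝒳 𝒴} [IsMarkovKernel W]
  {q : 𝒳 → 𝒴 → ℝ} {d : 𝒳 → 𝒳 → ℝ}

lemma le_measure_farSet {n m : ℕ} {Q : Measure (Fin n → 𝒳)} [IsProbabilityMeasure Q]
    (hd : Measurable fun p : 𝒳 × 𝒳 => d p.1 p.2) {Δ b t : ℝ} (hb : 0 ≤ b)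
    {C : Fin m → Fin n → 𝒳} (hC : ∀ i, Q {x | avg₂ d (C i) x ≤ Δ} ≤ ENNReal.ofReal b)
    (hm : m * b ≤ t) : ENNReal.ofReal (1 - t) ≤ Q (farSet d Δ C) := by
  have hsub : (farSet d Δ C)ᶜ ⊆ ⋃ i, {x | avg₂ d (C i) x ≤ Δ} := by
    intro x hx
    simp only [farSet, Set.mem_compl_iff, Set.mem_ofPred_eq, not_forall, not_lt] at hx
    simpa using hx
  have hcompl : Q (farSet d Δ C)ᶜ ≤ ENNReal.ofReal t := by
    calc _ ≤ ∑ i, Q {x | avg₂ d (C i) x ≤ Δ} :=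
          (measure_mono hsub).trans (measure_iUnion_fintype_le _ _)
      _ ≤ ∑ _i : Fin m, ENNReal.ofReal b := Finset.sum_le_sum fun i _ => hC i
      _ = ENNReal.ofReal (m * b) := by
          simp [ENNReal.ofReal_mul]
      _ ≤ _ := ENNReal.ofReal_le_ofReal hm
  have ht : 0 ≤ t := le_trans (by positivity) hm
  rw [ENNReal.ofReal_sub _ ht, ENNReal.ofReal_one, tsub_le_iff_right,
    ← prob_add_prob_compl (μ := Q) (measurableSet_farSet hd Δ C)]
  gcongr

lemma eventually_le_exp_mul {g : ℝ} (hg : 0 < g) (b : ℝ) :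
    ∀ᶠ n : ℕ in atTop, b ≤ Real.exp (n * g) :=
  (Real.tendsto_exp_atTop.comp
    (tendsto_natCast_atTop_atTop.atTop_mul_const hg)).eventually_ge_atTop b

lemma measurable_auxCosts (hq : Measurable fun p : 𝒳 × 𝒴 => q p.1 p.2)
    (hd : Measurable fun p : 𝒳 × 𝒳 => d p.1 p.2) {Δ r₁ ρ r s : ℝ} {a₁ a : 𝒳 → ℝ}
    (ha₁ : Measurable a₁) (ha : Measurable a) (j : Fin 4) :
    Measurable ((![a₁, rateCost P d Δ r₁ a₁, a, expCost P W q d Δ ρ r s a] :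
      Fin 4 → 𝒳 → ℝ) j) := by
  fin_cases j
  exacts [ha₁, measurable_rateCost hd Δ r₁ ha₁, ha, measurable_expCost hq hd Δ ρ r s ha]

lemma eventually_ensembleError_le (hq : Measurable fun p : 𝒳 × 𝒴 => q p.1 p.2)
    (hd : Measurable fun p : 𝒳 × 𝒳 => d p.1 p.2) (hsymm : ∀ x x', d x x' = d x' x)
    {L : ℕ} {c : Fin L → 𝒳 → ℝ} {Γ : Fin L → ℝ} (hc : ∀ l, Measurable (c l))
    (hcint : ∀ l, Integrable (c l) P) (hcΓ : ∀ l, ∫ x, c l x ∂P < Γ l)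
    {R Δ δ E r₁ ρ r s ε : ℝ} {a₁ a : 𝒳 → ℝ} (hδ : 0 < δ) (hε : 0 < ε)
    (hrate : RateParams P d Δ r₁ a₁) (hrε : R + δ + 2 * ε < rateValue P d Δ r₁ a₁)
    (hexp : ExpParams P W q d Δ ρ r s a) (hEε : E + 3 * ε < expValue P W q d Δ R ρ r s a) :
    ∀ᶠ n : ℕ in atTop, ∀ Q : Measure (Fin n → 𝒳),
      Q = inputLaw P ![a₁, rateCost P d Δ r₁ a₁, a, expCost P W q d Δ ρ r s a] ε c Γ n →
      IsProbabilityMeasure Q ∧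
      ∀ M : ℕ, 1 ≤ M → (M : ℝ) ≤ Real.exp (n * R) →
        (∀ m < M, ∀ᵐ C ∂(codebookLaw Q d Δ m),
          ENNReal.ofReal (1 - Real.exp (-(n * δ))) ≤ Q (farSet d Δ C)) ∧
        IsProbabilityMeasure (codebookLaw Q d Δ M) ∧
        ensembleError W q Q d Δ M ≤ ENNReal.ofReal (Real.exp (-(n * E))) := by
  set cost : Fin 4 → 𝒳 → ℝ := ![a₁, rateCost P d Δ r₁ a₁, a, expCost P W q d Δ ρ r s a]
    with hcost
  have hcm : ∀ j, Measurable (cost j) :=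
    measurable_auxCosts hq hd hrate.measurable hexp.measurable
  have hci : ∀ j, Integrable (cost j) P := by
    intro j
    fin_cases j
    exacts [hrate.integrable, hrate.integrable_cost, hexp.integrable, hexp.integrable_cost]
  -- The constants to absorb: 2 from conditioning in the near-word bound, 2 so that `κ ≥ 1/2`, and 8
  -- from `κ⁻² ≤ 4` times the 2 in the error bound.
  filter_upwards [eventually_half_le_costSet hcm hci hε hc hcint hcΓ,
    eventually_le_exp_mul (sub_pos.2 hrε) 2, eventually_le_exp_mul hδ 2,
    eventually_le_exp_mul (sub_pos.2 hEε) 8] with n hhalf hn₁ hn₂ hn₃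
  rintro Q hQ
  set S := costSet P cost ε c Γ n with hS
  have hSm : MeasurableSet S := measurableSet_costSet P hcm ε hc Γ n
  have hQ' : Q = ProbabilityTheory.cond (Measure.pi fun _ => P) S := hQ
  have hQP : IsProbabilityMeasure Q := by
    rw [hQ']
    refine cond_isProbabilityMeasure fun h => ?_
    simp [h] at hhalf
  have hQS : ∀ᵐ x ∂Q, x ∈ S := by
    rw [hQ']
    exact ae_cond_mem hSm
  have hQpi : Q ≪ Measure.pi fun _ : Fin n => P := by
    rw [hQ']
    exact cond_absolutelyContinuous
  have hcoord {p : 𝒳 → Prop} (hp : ∀ᵐ x ∂P, p x) : ∀ᵐ x : Fin n → 𝒳 ∂Q, ∀ k, p (x k) :=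
    hQpi.ae_le (ae_all_iff.2 fun k =>
      (measurePreserving_eval (fun _ : Fin n => P) k).quasiMeasurePreserving.ae hp)
  refine ⟨hQP, fun M hM1 hMR => ?_⟩
  have hfar : ∀ m < M, ∀ᵐ C ∂(codebookLaw Q d Δ m),
      ENNReal.ofReal (1 - Real.exp (-(n * δ))) ≤ Q (farSet d Δ C) := by
    intro m hm
    -- Besides typicality, every letter must have a finite moment; this holds almost surely because
    -- `Q ≪ Pⁿ`.
    have hGm : MeasurableSet (S ∩ ⋂ k, {x : Fin n → 𝒳 | rateMoment P d Δ r₁ a₁ (x k) ≠ ⊤}) :=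
      hSm.inter (MeasurableSet.iInter fun k =>
        ((measurable_rateMoment hd Δ r₁ hrate.measurable).comp (measurable_pi_apply k))
          (measurableSet_singleton ⊤).compl)
    have hG : ∀ᵐ x ∂Q, x ∈ S ∩ ⋂ k, {x : Fin n → 𝒳 | rateMoment P d Δ r₁ a₁ (x k) ≠ ⊤} := by
      filter_upwards [hQS, hcoord hrate.finite] with x h1 h2
      exact ⟨h1, Set.mem_iInter.2 h2⟩
    filter_upwards [ae_codebookLaw_mem (Δ := Δ) hd hGm hG m] with C hC
    refine le_measure_farSet hd (b := 2 * Real.exp (n * (2 * ε - rateValue P d Δ r₁ a₁)))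
      (by positivity) (fun i => ?_) ?_
    · rw [hQ']
      exact cond_near_le hSm hhalf hd hrate.r_nonneg hrate.measurable
        (fun x hx => hx.1 0) ((hC i).1.1 1) (Set.mem_iInter.1 (hC i).2)
    · have hmM : (m : ℝ) ≤ Real.exp (n * R) := le_trans (by exact_mod_cast hm.le) hMR
      calc m * (2 * Real.exp (n * (2 * ε - rateValue P d Δ r₁ a₁)))
          ≤ Real.exp (n * R) * (Real.exp (n * (rateValue P d Δ r₁ a₁ - (R + δ + 2 * ε))) *
              Real.exp (n * (2 * ε - rateValue P d Δ r₁ a₁))) := by gcongr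
        _ = Real.exp (-(n * δ)) := by
            rw [← Real.exp_add, ← Real.exp_add]
            congr 1
            ring
  set κ : ENNReal := ENNReal.ofReal (1 - Real.exp (-(n * δ))) with hκ
  have hκhalf : 2⁻¹ ≤ κ := by
    have h1 : Real.exp (-(n * δ)) ≤ 1 / 2 := by
      rw [Real.exp_neg, one_div]
      exact inv_anti₀ two_pos hn₂
    rw [hκ, ← ENNReal.ofReal_ofNat, ← ENNReal.ofReal_inv_of_pos two_pos]
    exact ENNReal.ofReal_le_ofReal (by linarith)
  have hκ0 : κ ≠ 0 := fun h => by simp [h] at hκhalf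
  have hκ1 : κ ≤ 1 := ENNReal.ofReal_le_one.2 (by linarith [Real.exp_pos (-(n * δ))])
  have hκinv : κ⁻¹ ≤ 2 := ENNReal.inv_le_iff_inv_le.1 hκhalf
  refine ⟨hfar, isProbabilityMeasure_codebookLaw hd hκ0 hfar le_rfl, ?_⟩
  set B : ENNReal := ENNReal.ofReal
    (2 * Real.exp (n * (3 * ε - expValue P W q d Δ R ρ r s a))) with hB
  have hint : ∫⁻ x, ∫⁻ y, min 1 (M * confusionProb q Q d Δ x y) ∂(prodChannel W n x) ∂Q ≤ B := by
    calc _ ≤ ∫⁻ _x, B ∂Q := by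
          refine lintegral_mono_ae ?_
          filter_upwards [hQS, hcoord hexp.finite] with x hxS hxfin
          rw [hQ']
          exact lintegral_min_confusionProb_le hSm hhalf hq hd hexp hε.le
            (fun x hx => hx.1 2) hxS (hxS.1 3) hxfin hMR
      _ = B := by simp
  calc _ ≤ κ⁻¹ * κ⁻¹ * B :=
        (ensembleError_le hd hsymm W hq hκ0 hκ1 hfar).trans (mul_le_mul_right hint _)
    _ ≤ 2 * 2 * B := by gcongr
    _ = ENNReal.ofReal (8 * Real.exp (n * (3 * ε - expValue P W q d Δ R ρ r s a))) := by
        rw [hB, ← ENNReal.ofReal_ofNat, ← ENNReal.ofReal_mul zero_le_two,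
          ← ENNReal.ofReal_mul (by norm_num)]
        congr 1
        ring
    _ ≤ ENNReal.ofReal (Real.exp (n * (expValue P W q d Δ R ρ r s a - (E + 3 * ε))) *
          Real.exp (n * (3 * ε - expValue P W q d Δ R ρ r s a))) := by gcongr
    _ = _ := by
        rw [← Real.exp_add]
        congr 2
        ring

lemma exists_codebook_of_ensembleError_le (hq : Measurable fun p : 𝒳 × 𝒴 => q p.1 p.2)
    (hd : Measurable fun p : 𝒳 × 𝒳 => d p.1 p.2) {n M : ℕ} {Q : Measure (Fin n → 𝒳)}
    [IsProbabilityMeasure Q] {Δ : ℝ} [IsProbabilityMeasure (codebookLaw Q d Δ M)]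
    {G : Set (Fin n → 𝒳)} (hG : MeasurableSet G) (hQG : ∀ᵐ x ∂Q, x ∈ G) {B : ENNReal}
    (hB : ensembleError W q Q d Δ M ≤ B) :
    ∃ C : Fin M → Fin n → 𝒳, (∀ m, C m ∈ G) ∧ errorProb W q C ≤ B := by
  obtain ⟨C, hC, hle⟩ := exists_notMem_null_le_lintegral
    (measurable_errorProb W hq).aemeasurable (ae_iff.1 (ae_codebookLaw_mem (Δ := Δ) hd hG hQG M))
  exact ⟨C, by simpa using hC, hle.trans hB⟩

lemma le_neg_log_div {e : ENNReal} {n : ℕ} (hn : 0 < n) {E : ℝ}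
    (he : e ≤ ENNReal.ofReal (Real.exp (-(n * E)))) :
    (E : EReal) ≤ -(ENNReal.log e) / (n : EReal) := by
  have hlog : ENNReal.log e ≤ ((-(n * E) : ℝ) : EReal) := by
    refine (ENNReal.log_monotone he).trans_eq ?_
    rw [ENNReal.log_ofReal_of_pos (Real.exp_pos _), Real.log_exp]
  rw [EReal.le_div_iff_mul_le (by exact_mod_cast hn) (EReal.natCast_ne_top n)]
  refine EReal.le_neg_of_le_neg (hlog.trans_eq ?_)
  push_cast
  rw [mul_comm]

omit [IsMarkovKernel W] in
lemma achievable_of_exists (hR : 0 < R) {L : ℕ} {c : Fin L → 𝒳 → ℝ} {Γ : Fin L → ℝ} {E : ℝ}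
    [Nonempty 𝒳]
    (h : ∀ E' < E, ∀ᶠ n : ℕ in atTop, ∀ M : ℕ, 1 ≤ M → (M : ℝ) ≤ Real.exp (n * R) →
      ∃ C : Fin M → Fin n → 𝒳, (∀ m l, avg (c l) (C m) ≤ Γ l) ∧
        errorProb W q C ≤ ENNReal.ofReal (Real.exp (-(n * E')))) :
    Achievable W q c Γ R E := by
  intro ε hε
  -- Good codebooks exist only for large `n`; at the other lengths an arbitrary one is taken, which
  -- uses that the alphabet is nonempty.
  have h' : ∀ n : ℕ, ∃ C : Fin ⌊Real.exp (n * R)⌋₊ → Fin n → 𝒳,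
      (∃ C : Fin ⌊Real.exp (n * R)⌋₊ → Fin n → 𝒳, (∀ m l, avg (c l) (C m) ≤ Γ l) ∧
        errorProb W q C ≤ ENNReal.ofReal (Real.exp (-(n * (E - ε))))) →
      (∀ m l, avg (c l) (C m) ≤ Γ l) ∧
        errorProb W q C ≤ ENNReal.ofReal (Real.exp (-(n * (E - ε)))) := by
    intro n
    by_cases hex : ∃ C : Fin ⌊Real.exp (n * R)⌋₊ → Fin n → 𝒳,
      (∀ m l, avg (c l) (C m) ≤ Γ l) ∧
        errorProb W q C ≤ ENNReal.ofReal (Real.exp (-(n * (E - ε))))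
    · exact ⟨hex.choose, fun _ => hex.choose_spec⟩
    · exact ⟨Classical.arbitrary _, fun hn => (hex hn).elim⟩
  choose C hC using h'
  have hgood : ∀ᶠ n : ℕ in atTop, (∀ m l, avg (c l) (C n m) ≤ Γ l) ∧
      errorProb W q (C n) ≤ ENNReal.ofReal (Real.exp (-(n * (E - ε)))) := by
    filter_upwards [h (E - ε) (by linarith)] with n hn
    refine hC n (hn _ ?_ (Nat.floor_le (Real.exp_pos _).le))
    rw [Nat.one_le_floor_iff]
    exact Real.one_le_exp (by positivity)
  refine ⟨fun n => ⌊Real.exp (n * R)⌋₊, C, ?_, ?_⟩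
  · filter_upwards [hgood, eventually_le_exp_mul hε 2] with n hn hn2
    refine ⟨?_, hn.1⟩
    have h1 : Real.exp (n * R) = Real.exp (n * (R - ε)) * Real.exp (n * ε) := by
      rw [← Real.exp_add]
      congr 1
      ring
    -- The factor 2 pays for the floor: a natural number `N ≥ 1` satisfies `N + 1 ≤ 2N`.
    have h2 : 2 * Real.exp (n * (R - ε)) ≤ Real.exp (n * R) := by
      rw [h1, mul_comm]
      gcongr
    have h3 : 1 ≤ Real.exp (n * R) := Real.one_le_exp (by positivity)
    have h4 := Nat.lt_floor_add_one (Real.exp (n * R))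
    have h5 : (1 : ℝ) ≤ ⌊Real.exp (n * R)⌋₊ := by
      exact_mod_cast (Nat.one_le_floor_iff _).2 h3
    linarith
  · refine le_liminf_of_le (by isBoundedDefault) ?_
    filter_upwards [hgood, eventually_gt_atTop 0] with n hn hn0
    exact le_neg_log_div hn0 hn.2

end RandomCoding

end RGV

/-! ### Choice of parameters. -/

theorem mainTheorem9 {𝒳 𝒴 : Type*} [MeasurableSpace 𝒳] [MeasurableSpace 𝒴]
    (P : Measure 𝒳) [IsProbabilityMeasure P] (W : Kernel 𝒳 𝒴) [IsMarkovKernel W]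
    (q : 𝒳 → 𝒴 → ℝ) (hq : Measurable fun p : 𝒳 × 𝒴 => q p.1 p.2)
    (d : 𝒳 → 𝒳 → ℝ) (hd : Measurable fun p : 𝒳 × 𝒳 => d p.1 p.2)
    (hsymm : ∀ x x', d x x' = d x' x)
    {L : ℕ} (c : Fin L → 𝒳 → ℝ) (Γ : Fin L → ℝ) (hc : ∀ l, Measurable (c l))
    (hcint : ∀ l, Integrable (c l) P) (hcΓ : ∀ l, ∫ x, c l x ∂P < Γ l)
    (R Δ δ : ℝ) (hR : 0 < R) (hδ : 0 < δ)
    (hrate : (R : EReal) ≤ RGV.dualRate P d Δ - ((2 * δ : ℝ) : EReal)) :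
    (∀ E : ℝ, (E : EReal) < RGV.dualExponent P W q d Δ R →
      ∃ (r₁ : ℝ) (a₁ : 𝒳 → ℝ) (ρ r s : ℝ) (a : 𝒳 → ℝ),
        RGV.RateParams P d Δ r₁ a₁ ∧ R + δ < RGV.rateValue P d Δ r₁ a₁ ∧
        RGV.ExpParams P W q d Δ ρ r s a ∧ E < RGV.expValue P W q d Δ R ρ r s a ∧
        ∃ ε₀ : ℝ, 0 < ε₀ ∧ ∀ ε : ℝ, 0 < ε → ε ≤ ε₀ →
          ∀ᶠ n : ℕ in atTop, ∀ Q : Measure (Fin n → 𝒳),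
            Q = RGV.inputLaw P
              ![a₁, RGV.rateCost P d Δ r₁ a₁, a, RGV.expCost P W q d Δ ρ r s a] ε c Γ n →
            IsProbabilityMeasure Q ∧
            ∀ M : ℕ, 1 ≤ M → (M : ℝ) ≤ Real.exp (n * R) →
              (∀ m < M, ∀ᵐ C ∂(RGV.codebookLaw Q d Δ m),
                ENNReal.ofReal (1 - Real.exp (-(n * δ))) ≤ Q (RGV.farSet d Δ C)) ∧
              IsProbabilityMeasure (RGV.codebookLaw Q d Δ M) ∧
              RGV.ensembleError W q Q d Δ M ≤ ENNReal.ofReal (Real.exp (-(n * E)))) ∧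
    (∀ E : ℝ, (E : EReal) ≤ RGV.dualExponent P W q d Δ R → RGV.Achievable W q c Γ R E) := by
  -- One of the two `δ` gives the decay `e^{-nδ}`; the other leaves a strict gap, so near-optimal
  -- rate parameters exist.
  have hrate' : ((R + δ : ℝ) : EReal) < RGV.dualRate P d Δ := by
    refine lt_of_lt_of_le ?_ (EReal.add_le_of_le_sub hrate)
    rw [← EReal.coe_add, EReal.coe_lt_coe_iff]
    linarith
  obtain ⟨_, ⟨r₁, a₁, hrp, rfl⟩, hr₁⟩ := lt_sSup_iff.1 hrate'
  rw [EReal.coe_lt_coe_iff] at hr₁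
  have part1 : ∀ E : ℝ, (E : EReal) < RGV.dualExponent P W q d Δ R →
      ∃ (ρ r s : ℝ) (a : 𝒳 → ℝ), RGV.ExpParams P W q d Δ ρ r s a ∧
        E < RGV.expValue P W q d Δ R ρ r s a := by
    intro E hE
    obtain ⟨_, ⟨ρ, r, s, a, hep, rfl⟩, hE'⟩ := lt_sSup_iff.1 hE
    exact ⟨ρ, r, s, a, hep, EReal.coe_lt_coe_iff.1 hE'⟩
  refine ⟨fun E hE => ?_, fun E hE => ?_⟩
  · obtain ⟨ρ, r, s, a, hep, hE'⟩ := part1 E hE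
    refine ⟨r₁, a₁, ρ, r, s, a, hrp, hr₁, hep, hE',
      -- The rate bound loses `2ε` and the exponent bound `3ε`, so a quarter of each gap keeps both
      -- inequalities strict.
      min ((RGV.rateValue P d Δ r₁ a₁ - (R + δ)) / 4)
        ((RGV.expValue P W q d Δ R ρ r s a - E) / 4),
      lt_min (by linarith) (by linarith), fun ε hε hε₀ => ?_⟩
    have h1 := hε₀.trans (min_le_left _ _)
    have h2 := hε₀.trans (min_le_right _ _)
    exact RGV.eventually_ensembleError_le hq hd hsymm hc hcint hcΓ hδ hε hrp (by linarith) hep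
      (by linarith)
  · have := nonempty_of_isProbabilityMeasure P
    refine RGV.achievable_of_exists hR fun E' hE' => ?_
    -- The endpoint `E` equal to the supremum is covered because achievability only asks for each
    -- smaller `E'`.
    obtain ⟨ρ, r, s, a, hep, hlt⟩ := part1 E' ((EReal.coe_lt_coe_iff.2 hE').trans_le hE)
    obtain ⟨ε, hε, hε1, hε2⟩ : ∃ ε : ℝ, 0 < ε ∧ R + δ + 2 * ε < RGV.rateValue P d Δ r₁ a₁ ∧
        E' + 3 * ε < RGV.expValue P W q d Δ R ρ r s a := by
      refine ⟨min ((RGV.rateValue P d Δ r₁ a₁ - (R + δ)) / 4)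
        ((RGV.expValue P W q d Δ R ρ r s a - E') / 4), lt_min (by linarith) (by linarith), ?_, ?_⟩
      · linarith [min_le_left ((RGV.rateValue P d Δ r₁ a₁ - (R + δ)) / 4)
          ((RGV.expValue P W q d Δ R ρ r s a - E') / 4)]
      · linarith [min_le_right ((RGV.rateValue P d Δ r₁ a₁ - (R + δ)) / 4)
          ((RGV.expValue P W q d Δ R ρ r s a - E') / 4)]
    filter_upwards [RGV.eventually_ensembleError_le hq hd hsymm hc hcint hcΓ hδ hε hrp hε1 hep
      hε2] with n hn M hM1 hMR
    obtain ⟨hQ, hQM⟩ := hn _ rfl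
    obtain ⟨-, hlaw, herr⟩ := hQM M hM1 hMR
    have hGm : MeasurableSet {x : Fin n → 𝒳 | ∀ l, RGV.avg (c l) x ≤ Γ l} := by
      rw [Set.ofPred_forall]
      exact MeasurableSet.iInter fun l =>
        measurableSet_le (RGV.measurable_avg (hc l)) measurable_const
    refine RGV.exists_codebook_of_ensembleError_le hq hd hGm ?_ herr
    have hS := ae_cond_mem (μ := Measure.pi fun _ : Fin n => P) (RGV.measurableSet_costSet P
      (RGV.measurable_auxCosts (P := P) (W := W) (Δ := Δ) (r₁ := r₁) (ρ := ρ) (r := r) (s := s)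
        hq hd hrp.measurable hep.measurable) ε hc Γ n)
    exact hS.mono fun x hx => hx.2
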